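/- Let $f:[0,\infty)\to\mathbb{R}$ be a regular standard monotone function: $0\le A\le B$ implies $f(A)\le f(B)$ for complex matrices of every size, $f(x)=xf(1/x)$ for $x>0$, $f(1)=1$, and $f(0)=\lim_{x\to 0^+}f(x)\neq 0$. Let $H$ be a (possibly unbounded) self-adjoint operator, the Hamiltonian, on a complex Hilbert space $\mathcal{H}$. For a state (density operator) $\rho=\sum_i\lambda_i|i\rangle\langle i|$, put $\rho_t=e^{-\mathrm{i}Ht}\rho e^{\mathrm{i}Ht}$ and define the metric adjusted skew information $$I^f(\rho,H)=\frac{f(0)}{2}\sum_{i,j}c_f(\lambda_i,\lambda_j)\,\bigl|\langle i|\partial_t\rho_t|_{t=0}|j\rangle\bigr|^2,\qquad c_f(x,y)=\frac{1}{yf(x/y)},$$ where $(|i\rangle)_i$ is an orthonormal eigenbasis of $\rho$, $c_f(x,0)=\frac{1}{xf(0)}$ for $x>0$, pairs with $\lambda_i=\lambda_j=0$ are omitted, and $I^f(\rho,H)=+\infty$ if $t\mapsto\rho_t$ is not differentiable in operator norm at $t=0$. With the trace distance $D(\rho,\sigma)=\frac12\|\rho-\sigma\|_1$ let $$I^f_\epsilon(\rho,H)=\inf\{I^f(\sigma,H):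 \sigma\text{ a state},\ D(\rho,\sigma)\le\epsilon\},$$ and for sequences of states $\widehat\rho=\{\rho_m\}_m$ and Hamiltonians $\widehat H=\{H_m\}_m$ let $$I^f_+(\widehat\rho,\widehat H)=\lim_{\epsilon\to0^+}\limsup_{m\to\infty}\frac1m I^f_\epsilon(\rho_m,H_m),\qquad I^f_-(\widehat\rho,\widehat H)=\lim_{\epsilon\to0^+}\liminf_{m\to\infty}\frac1m I^f_\epsilon(\rho_m,H_m).$$ Theorem. Let $\psi$ be a pure state, given by a unit vector $|\psi\rangle\in\mathcal{H}$, of period $2\pi$, that is, $\inf\{t>0:|\langle\psi|e^{-\mathrm{i}tH}|\psi\rangle|=1\}=2\pi$, and assume that $\langle\psi||H|^3|\psi\rangle<\infty$. Let $R>0$, and consider the sequences $\widehat\psi=\{\psi^{\otimes\lceil Rm\rceil}\}_m$ and $\widehat H=\{H_{\lceil Rm\rceil}\}_m$, where $H_k=\sum_{i=1}^k \mathbb{I}^{\otimes (i-1)}\otimes H\otimes\mathbb{I}^{\otimes (k-i)}$ on $\mathcal{H}^{\otimes k}$. Then $$I^f_+(\widehat\psi,\widehat H)=I^f_-(\widehat\psi,\widehat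 H)=\lim_{m\to\infty}\frac1m I^f\bigl(\psi^{\otimes\lceil Rm\rceil},H_{\lceil Rm\rceil}\bigr)=R\,I^f(\psi,H)=R\,\mathrm{Var}(\psi,H),$$ where $\mathrm{Var}(\psi,H)=\langle\psi|H^2|\psi\rangle-\langle\psi|H|\psi\rangle^2$. In particular $|\psi\rangle$ lies in the domain of $H$, all these limits exist and they are finite. -/

import Mathlib

open Filter Topology MeasureTheory
open scoped ComplexOrder ENNReal InnerProductSpace TensorProduct

universe u

namespace Asymmetry

/-! ## Hamiltonians and quantum systems -/

/-- A strongly continuous one-parameter unitary group `t ↦ U t = exp (-i t H)` on a complex Hilbert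
space.  By Stone's theorem these groups correspond one-to-one to the (possibly unbounded)
self-adjoint operators `H`; the operator of a group is `UnitaryGroup.hamiltonian` below. -/
structure UnitaryGroup (E : Type u) [NormedAddCommGroup E] [InnerProductSpace ℂ E] where
  U : ℝ → E ≃ₗᵢ[ℂ] E
  map_add : ∀ (s t : ℝ) (x : E), U (s + t) x = U s (U t x)
  continuous : ∀ x : E, Continuous fun t : ℝ => U t x

/-- The Hamiltonian `H` of `U t = exp (-i t H)`: its domain consists of the vectors `x` for which
`t ↦ U t x` is differentiable at `0`, and `H x = i (d/dt) U t x` at `t = 0`. -/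
noncomputable def UnitaryGroup.hamiltonian {E : Type u} [NormedAddCommGroup E]
    [InnerProductSpace ℂ E] (G : UnitaryGroup E) : E →ₗ.[ℂ] E where
  domain :=
    { carrier := {x | DifferentiableAt ℝ (fun t : ℝ => G.U t x) 0}
      add_mem' := fun {x y} hx hy => by
        simp only [Set.mem_ofPred_eq, _root_.map_add] at *
        exact hx.add hy
      zero_mem' := by simp
      smul_mem' := fun c x hx => by
        simp only [Set.mem_ofPred_eq, map_smul] at *
        exact hx.const_smul c }
  toFun :=
    { toFun := fun x => Complex.I • deriv (fun t : ℝ => G.U t (x : E)) 0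
      map_add' := fun x y => by
        have h := (x.2.hasDerivAt.add y.2.hasDerivAt).deriv
        rw [← smul_add, ← h]
        congr 2
        ext t
        simp
      map_smul' := fun c x => by
        have h := (x.2.hasDerivAt.const_smul c).deriv
        rw [RingHom.id_apply, smul_comm c, ← h]
        congr 2
        ext t
        simp }

/-- A quantum system: a complex Hilbert space (of any dimension) with a Hamiltonian, given by the
unitary group that it generates. -/
structure QSystem where
  carrier : Type u
  [normed : NormedAddCommGroup carrier]
  [inner : InnerProductSpace ℂ carrier]
  [complete : CompleteSpace carrier]
  evol : UnitaryGroup carrier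

attribute [instance] QSystem.normed QSystem.inner QSystem.complete

/-- The Hamiltonian of a system. -/
noncomputable def QSystem.H (S : QSystem.{u}) : S.carrier →ₗ.[ℂ] S.carrier := S.evol.hamiltonian

/-! ## Composite systems and independent copies -/

section Tensor

variable {E F : Type u} [NormedAddCommGroup E] [InnerProductSpace ℂ E]
  [NormedAddCommGroup F] [InnerProductSpace ℂ F]

variable (E F) in
/-- The Hilbert space tensor product: the completion of the algebraic tensor product for the inner
product determined by `⟪x ⊗ y, x' ⊗ y'⟫ = ⟪x, x'⟫ ⟪y, y'⟫`. -/
abbrev HTensor : Type u := UniformSpace.Completion (E ⊗[ℂ] F)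

/-- The product vector `x ⊗ y`. -/
noncomputable def hTmul (x : E) (y : F) : HTensor E F := ((x ⊗ₜ[ℂ] y : E ⊗[ℂ] F) : HTensor E F)

/-- The unitary `V ⊗ W` on the Hilbert space tensor product. -/
noncomputable def hMap (V : E ≃ₗᵢ[ℂ] E) (W : F ≃ₗᵢ[ℂ] F) : HTensor E F ≃ₗᵢ[ℂ] HTensor E F :=
  (TensorProduct.congrIsometry V W).toLinearEquiv.extendOfIsometry
    (UniformSpace.Completion.toComplₗᵢ (𝕜 := ℂ) (E := E ⊗[ℂ] F)).toLinearMap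
    (UniformSpace.Completion.toComplₗᵢ (𝕜 := ℂ) (E := E ⊗[ℂ] F)).toLinearMap
    UniformSpace.Completion.denseRange_coe UniformSpace.Completion.denseRange_coe
    (fun x => by
      rw [LinearIsometry.coe_toLinearMap, LinearIsometry.norm_map, LinearIsometry.norm_map]
      exact (TensorProduct.congrIsometry V W).norm_map x)

theorem hMap_coe (V : E ≃ₗᵢ[ℂ] E) (W : F ≃ₗᵢ[ℂ] F) (z : E ⊗[ℂ] F) :
    hMap V W (z : HTensor E F) = ((TensorProduct.congrIsometry V W z : E ⊗[ℂ] F) : HTensor E F) :=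
  LinearEquiv.extendOfIsometry_eq _ _ _ _ _ _ z

theorem hMap_hTmul (V : E ≃ₗᵢ[ℂ] E) (W : F ≃ₗᵢ[ℂ] F) (x : E) (y : F) :
    hMap V W (hTmul x y) = hTmul (V x) (W y) := by
  simp [hTmul, hMap_coe]

theorem inner_hTmul (x x' : E) (y y' : F) :
    ⟪hTmul x y, hTmul x' y'⟫_ℂ = ⟪x, x'⟫_ℂ * ⟪y, y'⟫_ℂ := by
  simp [hTmul]

/-- The group `exp (-i t H) ⊗ exp (-i t H')`, whose Hamiltonian is the additive Hamiltonian
`H ⊗ 1 + 1 ⊗ H'` (see `hamiltonian_prod_hTmul`). -/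
noncomputable def UnitaryGroup.prod (G : UnitaryGroup E) (K : UnitaryGroup F) :
    UnitaryGroup (HTensor E F) where
  U t := hMap (G.U t) (K.U t)
  map_add s t x := by
    induction x using UniformSpace.Completion.induction_on with
    | hp =>
      exact isClosed_eq (LinearIsometryEquiv.continuous _)
        ((LinearIsometryEquiv.continuous _).comp (LinearIsometryEquiv.continuous _))
    | ih z =>
      rw [hMap_coe, hMap_coe, hMap_coe]
      congr 1
      induction z with
      | zero => simp
      | tmul x y => simp [G.map_add, K.map_add]
      | add a b ha hb => rw [_root_.map_add, _root_.map_add, _root_.map_add, ha, hb]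
  continuous x := by
    have key : ∀ z : E ⊗[ℂ] F,
        Continuous fun t : ℝ => hMap (G.U t) (K.U t) (z : HTensor E F) := by
      intro z
      simp_rw [hMap_coe]
      refine (UniformSpace.Completion.continuous_coe _).comp ?_
      induction z with
      | zero => simpa using continuous_const
      | tmul x y =>
        simp only [TensorProduct.congrIsometry_apply, TensorProduct.congr_tmul]
        exact TensorProduct.continuous_tmul.comp ((G.continuous x).prodMk (K.continuous y))
      | add a b ha hb =>
        simp only [_root_.map_add]
        exact ha.add hb
    refine continuous_of_uniform_approx_of_continuous fun s hs => ?_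
    obtain ⟨ε, hε, hεs⟩ := Metric.mem_uniformity_dist.1 hs
    obtain ⟨z, hz⟩ := UniformSpace.Completion.denseRange_coe.exists_dist_lt x hε
    exact ⟨_, key z, fun t => hεs (by rwa [LinearIsometryEquiv.dist_map])⟩

theorem hTmul_add_left (x x' : E) (y : F) : hTmul (x + x') y = hTmul x y + hTmul x' y := by
  simp only [hTmul, TensorProduct.add_tmul]
  exact UniformSpace.Completion.coe_add _ _

theorem hTmul_add_right (x : E) (y y' : F) : hTmul x (y + y') = hTmul x y + hTmul x y' := by
  simp only [hTmul, TensorProduct.tmul_add]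
  exact UniformSpace.Completion.coe_add _ _

theorem hTmul_smul_left (c : ℂ) (x : E) (y : F) : hTmul (c • x) y = c • hTmul x y := by
  simp only [hTmul, ← TensorProduct.smul_tmul']
  exact UniformSpace.Completion.coe_smul _ _

theorem hTmul_smul_right (c : ℂ) (x : E) (y : F) : hTmul x (c • y) = c • hTmul x y := by
  simp only [hTmul, TensorProduct.tmul_smul]
  exact UniformSpace.Completion.coe_smul _ _

theorem isBoundedBilinearMap_hTmul :
    IsBoundedBilinearMap ℝ (fun p : E × F => hTmul p.1 p.2) where
  add_left x x' y := hTmul_add_left x x' y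
  add_right x y y' := hTmul_add_right x y y'
  smul_left c x y := by simpa only [Complex.coe_smul] using hTmul_smul_left (c : ℂ) x y
  smul_right c x y := by simpa only [Complex.coe_smul] using hTmul_smul_right (c : ℂ) x y
  bound := ⟨1, one_pos, fun x y => by simp [hTmul]⟩

/-- The Hamiltonian of the product group acts as `H ⊗ 1 + 1 ⊗ H'`. -/
theorem hamiltonian_prod_hTmul (G : UnitaryGroup E) (K : UnitaryGroup F)
    (x : G.hamiltonian.domain) (y : K.hamiltonian.domain) :
    ∃ h : hTmul (x : E) (y : F) ∈ (G.prod K).hamiltonian.domain,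
      (G.prod K).hamiltonian ⟨hTmul (x : E) (y : F), h⟩ =
        hTmul (G.hamiltonian x) (y : F) + hTmul (x : E) (K.hamiltonian y) := by
  have hG : G.U 0 (x : E) = x := (G.U 0).injective (by rw [← G.map_add, add_zero])
  have hK : K.U 0 (y : F) = y := (K.U 0).injective (by rw [← K.map_add, add_zero])
  have hx : HasDerivAt (fun t : ℝ => G.U t (x : E)) _ 0 := DifferentiableAt.hasDerivAt x.2
  have hy : HasDerivAt (fun t : ℝ => K.U t (y : F)) _ 0 := DifferentiableAt.hasDerivAt y.2
  have h := (isBoundedBilinearMap_hTmul (E := E) (F := F)).hasFDerivAt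
    (G.U 0 (x : E), K.U 0 (y : F)) |>.comp_hasDerivAt (0 : ℝ) (hx.prodMk hy)
  have h' : HasDerivAt (fun t : ℝ => (G.prod K).U t (hTmul (x : E) (y : F)))
      (hTmul (x : E) (deriv (fun t : ℝ => K.U t (y : F)) 0) +
        hTmul (deriv (fun t : ℝ => G.U t (x : E)) 0) (y : F)) 0 := by
    simp only [hG, hK] at h
    change HasDerivAt _ (hTmul (x : E) (deriv (fun t : ℝ => K.U t (y : F)) 0) +
        hTmul (deriv (fun t : ℝ => G.U t (x : E)) 0) (y : F)) 0 at h
    refine h.congr_of_eventuallyEq (Eventually.of_forall fun t => ?_)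
    exact hMap_hTmul (G.U t) (K.U t) (x : E) (y : F)
  refine ⟨h'.differentiableAt, ?_⟩
  change Complex.I • deriv (fun t : ℝ => (G.prod K).U t (hTmul (x : E) (y : F))) 0 =
    hTmul (Complex.I • deriv (fun t : ℝ => G.U t (x : E)) 0) (y : F) +
      hTmul (x : E) (Complex.I • deriv (fun t : ℝ => K.U t (y : F)) 0)
  rw [h'.deriv, add_comm, smul_add, hTmul_smul_left, hTmul_smul_right]

end Tensor

/-- The trivial system: the Hilbert space `ℂ` with Hamiltonian `0`. -/
noncomputable def QSystem.unit : QSystem.{u} where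
  carrier := EuclideanSpace ℂ PUnit.{u + 1}
  evol :=
    { U := fun _ => LinearIsometryEquiv.refl ℂ _
      map_add := fun _ _ _ => rfl
      continuous := fun _ => continuous_const }

/-- The composite of two systems, with Hamiltonian `H ⊗ 1 + 1 ⊗ H'`. -/
noncomputable def QSystem.tensor (S T : QSystem.{u}) : QSystem.{u} where
  carrier := HTensor S.carrier T.carrier
  evol := S.evol.prod T.evol

/-- `k` copies of a system, with the additive Hamiltonian `∑ i, 1 ⊗ ⋯ ⊗ H ⊗ ⋯ ⊗ 1`. -/
noncomputable def QSystem.copies (S : QSystem.{u}) : ℕ → QSystem.{u}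
  | 0 => QSystem.unit
  | k + 1 => S.tensor (S.copies k)

/-- The vector `ψ ⊗ ⋯ ⊗ ψ` of `k` copies of a system. -/
noncomputable def QSystem.tpow (S : QSystem.{u}) (ψ : S.carrier) :
    (k : ℕ) → (S.copies k).carrier
  | 0 => EuclideanSpace.single PUnit.unit (1 : ℂ)
  | k + 1 => hTmul (E := S.carrier) (F := (S.copies k).carrier) ψ (S.tpow ψ k)

/-! ## States -/

section States

variable {E : Type u} [NormedAddCommGroup E] [InnerProductSpace ℂ E] [CompleteSpace E]

/-- The trace of a positive operator, in `[0, ∞]`: the sum of the diagonal entries in an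
orthonormal basis.  The sum does not depend on the basis. -/
noncomputable def posTrace (A : E →L[ℂ] E) : ℝ≥0∞ :=
  ∑' i, ENNReal.ofReal (⟪(exists_hilbertBasis ℂ E).choose_spec.choose i,
    A ((exists_hilbertBasis ℂ E).choose_spec.choose i)⟫_ℂ).re

/-- The trace norm `‖A‖₁ = Tr |A|`, where `|A| = (A* A) ^ (1/2)`. -/
noncomputable def traceNorm (A : E →L[ℂ] E) : ℝ≥0∞ := posTrace (CFC.abs A)

/-- States are the density operators: positive operators of trace one. -/
def IsState (ρ : E →L[ℂ] E) : Prop := ρ.IsPositive ∧ posTrace ρ = 1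

/-- The trace distance `D(ρ, σ) = ‖ρ - σ‖₁ / 2`. -/
noncomputable def traceDist (ρ σ : E →L[ℂ] E) : ℝ≥0∞ := traceNorm (ρ - σ) / 2

/-- The pure state `|ψ⟩⟨ψ|` of a unit vector `ψ`. -/
noncomputable def pureState (ψ : E) : E →L[ℂ] E := InnerProductSpace.rankOne ℂ ψ ψ

/-! ## Energy -/

/-- `μ` is the energy distribution (spectral measure) of the unit vector `ψ`:
`⟨ψ| exp (-i t H) |ψ⟩ = ∫ exp (-i t x) dμ(x)` for all `t`. By the spectral theorem there is exactly
one such probability measure, and `⟨ψ| g(H) |ψ⟩ = ∫ g dμ`. -/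
def IsEnergyDistribution (G : UnitaryGroup E) (ψ : E) (μ : Measure ℝ) : Prop :=
  IsProbabilityMeasure μ ∧
    ∀ t : ℝ, ∫ x : ℝ, Complex.exp (-(Complex.I * t * x)) ∂μ = ⟪ψ, G.U t ψ⟫_ℂ

/-- `⟨ψ| |H| ^ k |ψ⟩ < ∞`. -/
def FiniteAbsMoment (G : UnitaryGroup E) (ψ : E) (k : ℕ) : Prop :=
  ∃ μ : Measure ℝ, IsEnergyDistribution G ψ μ ∧ Integrable (fun x : ℝ => |x| ^ k) μ

/-- The period of a pure state: `inf {t > 0 | |⟨ψ| exp (-i t H) |ψ⟩| = 1}`. -/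
noncomputable def period (G : UnitaryGroup E) (ψ : E) : ℝ :=
  sInf {t : ℝ | 0 < t ∧ ‖⟪ψ, G.U t ψ⟫_ℂ‖ = 1}

/-- The variance `Var(ψ, H) = ⟨ψ|H²|ψ⟩ - ⟨ψ|H|ψ⟩²` of an operator `H` (symmetric, so that
`⟨ψ|H²|ψ⟩ = ‖H ψ‖²`) in the pure state of a unit vector `ψ` of its domain. -/
noncomputable def variance (H : E →ₗ.[ℂ] E) (ψ : H.domain) : ℝ :=
  ‖H ψ‖ ^ 2 - (⟪(ψ : E), H ψ⟫_ℂ).re ^ 2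

end States

/-! ## Metric adjusted skew information -/

/-- Regular standard monotone functions `f : [0, ∞) → ℝ` (values of `f` at negative numbers play no
role): operator monotone, `f(x) = x f(1/x)`, `f(1) = 1`, `f(0) ≠ 0`.  As usual `f(0)` stands for
the limit of `f` at `0`. -/
structure IsRegularStandardMonotone (f : ℝ → ℝ) : Prop where
  operatorMonotone : ∀ (n : ℕ) (A B : Matrix (Fin n) (Fin n) ℂ),
    A.PosSemidef → (B - A).PosSemidef → (cfc f B - cfc f A).PosSemidef
  symmetric : ∀ x : ℝ, 0 < x → f x = x * f (1 / x)
  normalized : f 1 = 1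
  continuous_zero : ContinuousWithinAt f (Set.Ici 0) 0
  regular : f 0 ≠ 0

/-- The Morozova–Chentsov function `c(x, y) = 1 / (y f(x / y))`, extended by continuity to `y = 0`,
`x > 0` as `1 / (x f(0))`.  The value at `(0, 0)` is `0`: pairs of vectors of the kernel of the
state do not contribute to the quantum Fisher information. -/
noncomputable def morozovaChentsov (f : ℝ → ℝ) (x y : ℝ) : ℝ :=
  if y = 0 then (x * f 0)⁻¹ else (y * f (x / y))⁻¹

section Skew

variable {E : Type u} [NormedAddCommGroup E] [InnerProductSpace ℂ E] [CompleteSpace E]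

/-- The monotone metric `Tr (A c(L_ρ, R_ρ)(A))` at a state `ρ`, for a self-adjoint operator `A`: the
sum of `c(λ_i, λ_j) |⟨i|A|j⟩|²` over an orthonormal basis of eigenvectors `|i⟩` of `ρ` with
eigenvalues `λ_i`.  All these bases give the same sum; the infimum over them is only a way to
avoid a choice. -/
noncomputable def monotoneMetric (f : ℝ → ℝ) (ρ A : E →L[ℂ] E) : ℝ≥0∞ :=
  ⨅ (s : Set E) (b : HilbertBasis s ℂ E) (l : s → ℝ) (_ : ∀ i, ρ (b i) = (l i : ℂ) • b i),
    ∑' (i : s) (j : s),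
      ENNReal.ofReal (morozovaChentsov f (l i) (l j)) * ‖⟪b i, A (b j)⟫_ℂ‖ₑ ^ 2

open Classical in
/-- The quantum Fisher information `J` at parameter `t` of a family `r` of states:
the squared length of the derivative in the monotone metric.  It is infinite where the family is
not differentiable. -/
noncomputable def quantumFisher (f : ℝ → ℝ) (r : ℝ → E →L[ℂ] E) (t : ℝ) : ℝ≥0∞ :=
  if DifferentiableAt ℝ r t then monotoneMetric f (r t) (deriv r t) else ∞

/-- The unitary model `t ↦ exp (-i t H) ρ exp (i t H)`. -/
noncomputable def unitaryModel (G : UnitaryGroup E) (ρ : E →L[ℂ] E) (t : ℝ) : E →L[ℂ] E :=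
  ((G.U t : E →L[ℂ] E) ∘L ρ) ∘L (G.U (-t) : E →L[ℂ] E)

/-- The metric adjusted skew information `I^f(ρ, H)`. -/
noncomputable def skewInfo (f : ℝ → ℝ) (G : UnitaryGroup E) (ρ : E →L[ℂ] E) : ℝ≥0∞ :=
  ENNReal.ofReal (f 0 / 2) * quantumFisher f (unitaryModel G ρ) 0

/-- The smooth metric adjusted skew information: the infimum of `I^f(σ, H)` over the states `σ`
with `D(ρ, σ) ≤ ε`. -/
noncomputable def smoothSkewInfo (f : ℝ → ℝ) (ε : ℝ) (G : UnitaryGroup E) (ρ : E →L[ℂ] E) :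
    ℝ≥0∞ :=
  ⨅ (σ : E →L[ℂ] E) (_ : IsState σ) (_ : traceDist ρ σ ≤ ENNReal.ofReal ε), skewInfo f G σ

end Skew

/-- `I^f_+ = L` for a sequence of systems and states:
`L` is the limit of `limsup (1/m) I^f_ε(ρ_m, H_m)` as `ε → 0+`. -/
def HasSmoothSupRate (f : ℝ → ℝ) (S : ℕ → QSystem.{u})
    (ρ : (m : ℕ) → (S m).carrier →L[ℂ] (S m).carrier) (L : ℝ≥0∞) : Prop :=
  Tendsto (fun ε : ℝ =>
    limsup (fun m : ℕ => smoothSkewInfo f ε (S m).evol (ρ m) / (m : ℝ≥0∞)) atTop) (𝓝[>] 0) (𝓝 L)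

/-- `I^f_- = L` for a sequence of systems and states:
`L` is the limit of `liminf (1/m) I^f_ε(ρ_m, H_m)` as `ε → 0+`. -/
def HasSmoothInfRate (f : ℝ → ℝ) (S : ℕ → QSystem.{u})
    (ρ : (m : ℕ) → (S m).carrier →L[ℂ] (S m).carrier) (L : ℝ≥0∞) : Prop :=
  Tendsto (fun ε : ℝ =>
    liminf (fun m : ℕ => smoothSkewInfo f ε (S m).evol (ρ m) / (m : ℝ≥0∞)) atTop) (𝓝[>] 0) (𝓝 L)

end Asymmetry

open Asymmetry

namespace Asymmetry

/-! ### Parseval's identity in an orthonormal basis -/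

section HilbertBasis

variable {ι : Type*} {E : Type u} [NormedAddCommGroup E] [InnerProductSpace ℂ E]

/-! Write `V` for the variance and `U_t` for the evolution. For a pure state every `I^f` equals `V`,
the coefficient of `t²` in `1 - |⟨ψ, U_t ψ⟩|²` (`skewInfo_pureState_of_hasDerivAt`). Overlaps
multiply over independent copies, so this coefficient is additive (`QSystem.skewInfo_tpow`). Since a
state competes in its own smoothing infimum, both smooth rates are at most `R V`.

The lower bound is a speed limit used at a finite time. Let `σ` be within `ε` of `φ = ψ^{⊗k}` in
trace distance, hence within `δ = 2ε` in operator norm, and let `A` be the derivative of its orbit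
at `0`. An eigenbasis of `σ` contains a vector `χ` close to `φ` with eigenvalue at least `1 - δ`,
and `σ ≤ 3δ` on the complement of `χ`. The row and column of `χ` alone bound `I^f(σ, H)` below by
almost `‖A χ‖²` (`le_monotoneMetric`). The spectral gap `g = 1 - 4δ` turns `‖A χ‖` into a bound on
the motion of `χ` at all times: `1 - |⟨χ, U_t χ⟩|² ≤ ‖A χ‖² t² / g²`
(`one_sub_norm_inner_sq_le_of_hasDerivAt`). Replacing `χ` by `φ` costs `8√δ`, uniformly in `t`; so,
up to a factor tending to `1` with `δ → 0`, `I^f(σ, H)` is at least `(1 - |⟨φ, U_t φ⟩|² - 8√δ) / t²`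
for every `t > 0` (`le_skewInfo`).

The error term makes very small `t` useless. At `t = √(x/k)` the survival probability of `φ` tends
to `exp(-V x)` as `k → ∞`, so the bound per copy becomes `(1 - exp(-V x) - 8√δ) / x`. Letting `ε →
0` and only then `x → 0` gives `V`. -/

theorem hasSum_norm_inner_sq (b : HilbertBasis ι ℂ E) (x : E) :
    HasSum (fun i => ‖⟪b i, x⟫_ℂ‖ ^ 2) (‖x‖ ^ 2) := by
  have h := (b.hasSum_inner_mul_inner x x).mapL Complex.reCLM
  simp only [Complex.reCLM_apply] at h
  convert h using 1
  · ext i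
    rw [← inner_conj_symm x (b i), ← Complex.normSq_eq_conj_mul_self, Complex.ofReal_re,
      Complex.normSq_eq_norm_sq]
  · exact (inner_self_eq_norm_sq (𝕜 := ℂ) x).symm

theorem enorm_sq_eq_ofReal {F : Type*} [SeminormedAddCommGroup F] (x : F) :
    ‖x‖ₑ ^ 2 = ENNReal.ofReal (‖x‖ ^ 2) := by
  rw [ENNReal.ofReal_pow (norm_nonneg _), ofReal_norm]

theorem tsum_enorm_inner_sq (b : HilbertBasis ι ℂ E) (x : E) :
    ∑' i, ‖⟪b i, x⟫_ℂ‖ₑ ^ 2 = ‖x‖ₑ ^ 2 := by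
  simp_rw [enorm_sq_eq_ofReal]
  rw [← ENNReal.ofReal_tsum_of_nonneg (fun i => by positivity) (hasSum_norm_inner_sq b x).summable,
    (hasSum_norm_inner_sq b x).tsum_eq]

end HilbertBasis

/-! ### Operator norm, trace norm and trace distance -/

section TraceNorm

variable {E : Type u} [NormedAddCommGroup E] [InnerProductSpace ℂ E] [CompleteSpace E]

/-- The operator norm is dominated by the Hilbert–Schmidt norm. Applied to the square root of a
positive operator, whose squared Hilbert–Schmidt norm is the trace. -/
theorem enorm_apply_sq_le_tsum {ι : Type*} (b : HilbertBasis ι ℂ E) {S : E →L[ℂ] E}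
    (hS : IsSelfAdjoint S) (x : E) :
    ‖S x‖ₑ ^ 2 ≤ (∑' i, ‖S (b i)‖ₑ ^ 2) * ‖x‖ₑ ^ 2 := by
  rw [← tsum_enorm_inner_sq b (S x), ← ENNReal.tsum_mul_right]
  refine ENNReal.tsum_le_tsum fun i => ?_
  rw [← mul_pow]
  gcongr
  rw [← hS.isSymmetric.apply_clm (b i) x]
  simp only [← ofReal_norm]
  rw [← ENNReal.ofReal_mul (norm_nonneg _)]
  exact ENNReal.ofReal_le_ofReal (norm_inner_le_norm _ _)

/-- The operator norm of a positive operator is at most its trace. -/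
theorem enorm_le_posTrace {T : E →L[ℂ] E} (hT : 0 ≤ T) : ‖T‖ₑ ≤ posTrace T := by
  set b := (exists_hilbertBasis ℂ E).choose_spec.choose with hb
  set S := CFC.sqrt T with hSdef
  have hS : IsSelfAdjoint S := (CFC.sqrt_nonneg T).isSelfAdjoint
  have hST : S * S = T := CFC.sqrt_mul_sqrt_self T
  have hST' : ∀ x, S (S x) = T x := fun x => by rw [← hST]; rfl
  have htr : posTrace T = ∑' i, ‖S (b i)‖ₑ ^ 2 := by
    unfold posTrace
    refine tsum_congr fun i => ?_
    rw [enorm_sq_eq_ofReal, ← inner_self_eq_norm_sq (𝕜 := ℂ), ← hST', ← hb]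
    congr 2
    exact (hS.isSymmetric.apply_clm _ _).symm
  by_cases htop : posTrace T = ∞
  · simp [htop]
  rw [← ENNReal.ofReal_toReal htop, ← ofReal_norm]
  refine ENNReal.ofReal_le_ofReal ?_
  have hSle : ‖S‖ ≤ √(posTrace T).toReal := by
    refine S.opNorm_le_bound (Real.sqrt_nonneg _) fun x => ?_
    have h := enorm_apply_sq_le_tsum b hS x
    rw [← htr, enorm_sq_eq_ofReal, enorm_sq_eq_ofReal] at h
    rw [← ENNReal.ofReal_toReal htop, ← ENNReal.ofReal_mul ENNReal.toReal_nonneg,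
      ENNReal.ofReal_le_ofReal_iff (by positivity)] at h
    rw [← Real.sqrt_sq (norm_nonneg x), ← Real.sqrt_mul ENNReal.toReal_nonneg]
    exact Real.le_sqrt_of_sq_le h
  calc ‖T‖ ≤ ‖S‖ * ‖S‖ := by rw [← hST]; exact norm_mul_le _ _
    _ ≤ √(posTrace T).toReal * √(posTrace T).toReal := by gcongr
    _ = _ := Real.mul_self_sqrt ENNReal.toReal_nonneg

theorem enorm_le_traceNorm (B : E →L[ℂ] E) : ‖B‖ₑ ≤ traceNorm B := by
  have h := enorm_le_posTrace (CFC.abs_nonneg B)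
  rwa [← ofReal_norm, CFC.norm_abs, ofReal_norm] at h

theorem norm_sub_le_of_traceDist_le {ρ σ : E →L[ℂ] E} {ε : ℝ} (hε : 0 ≤ ε)
    (h : traceDist ρ σ ≤ ENNReal.ofReal ε) : ‖ρ - σ‖ ≤ 2 * ε := by
  have h1 : traceNorm (ρ - σ) ≤ ENNReal.ofReal ε * 2 :=
    (ENNReal.div_le_iff (by simp) (by simp)).1 h
  have h2 := (enorm_le_traceNorm (ρ - σ)).trans h1
  rw [← ofReal_norm, show (2 : ℝ≥0∞) = ENNReal.ofReal 2 by simp, ← ENNReal.ofReal_mul hε,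
    ENNReal.ofReal_le_ofReal_iff (by positivity)] at h2
  linarith

theorem traceDist_self (ρ : E →L[ℂ] E) : traceDist ρ ρ = 0 := by
  simp [traceDist, traceNorm, posTrace]

end TraceNorm

/-! ### Positivity and monotonicity of `f`; symmetry of the Morozova–Chentsov function -/

namespace IsRegularStandardMonotone

variable {f : ℝ → ℝ}

/-- Operator monotonicity for matrices of size one. -/
theorem monotoneOn (hf : IsRegularStandardMonotone f) : MonotoneOn f (Set.Ici 0) := by
  intro x hx y _ hxy
  have key : ∀ r : ℝ, 0 ≤ r →
      (algebraMap ℝ (Matrix (Fin 1) (Fin 1) ℂ) r).PosSemidef := fun r hr => by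
    rw [Matrix.algebraMap_eq_diagonal]
    exact Matrix.PosSemidef.diagonal fun i => by simpa using hr
  have h := hf.operatorMonotone 1 (algebraMap ℝ _ x) (algebraMap ℝ _ y) (key x hx)
    (by rw [← _root_.map_sub]; exact key _ (sub_nonneg.2 hxy))
  rw [cfc_algebraMap, cfc_algebraMap, ← _root_.map_sub] at h
  have h0 := h.diag_nonneg (i := 0)
  rw [Matrix.algebraMap_eq_diagonal, Matrix.diagonal_apply_eq] at h0
  have : (0 : ℂ) ≤ ((f y - f x : ℝ) : ℂ) := by simpa using h0
  exact sub_nonneg.1 (Complex.zero_le_real.1 this)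

theorem pos (hf : IsRegularStandardMonotone f) {x : ℝ} (hx : 0 < x) : 0 < f x := by
  rcases le_total 1 x with h | h
  · have := hf.monotoneOn (by simp : (1 : ℝ) ∈ Set.Ici 0) hx.le h
    rw [hf.normalized] at this
    linarith
  · have := hf.monotoneOn (by simp : (1 : ℝ) ∈ Set.Ici 0) (Set.mem_Ici.2 (by positivity))
      ((one_le_div hx).2 h)
    rw [hf.normalized] at this
    rw [hf.symmetric x hx]
    positivity

theorem zero_pos (hf : IsRegularStandardMonotone f) : 0 < f 0 := by
  refine lt_of_le_of_ne ?_ hf.regular.symm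
  have h : Tendsto f (𝓝[>] 0) (𝓝 (f 0)) :=
    hf.continuous_zero.mono_left (nhdsWithin_mono _ Set.Ioi_subset_Ici_self)
  exact ge_of_tendsto h (eventually_mem_nhdsWithin.mono fun x hx => (hf.pos hx).le)

theorem pos_of_nonneg (hf : IsRegularStandardMonotone f) {x : ℝ} (hx : 0 ≤ x) : 0 < f x := by
  rcases hx.eq_or_lt with rfl | h
  exacts [hf.zero_pos, hf.pos h]

/-- The symmetry of `f` moves the division to the positive argument, where one formula also covers
the convention at `y = 0`. -/
theorem morozovaChentsov_eq (hf : IsRegularStandardMonotone f) {x y : ℝ} (hx : 0 < x)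
    (hy : 0 ≤ y) : morozovaChentsov f x y = (x * f (y / x))⁻¹ := by
  unfold morozovaChentsov
  split_ifs with h
  · simp [h]
  · have hy' : 0 < y := lt_of_le_of_ne hy (Ne.symm h)
    rw [hf.symmetric (x / y) (by positivity), one_div_div]
    congr 1
    field_simp

theorem morozovaChentsov_comm (hf : IsRegularStandardMonotone f) {x y : ℝ} (hx : 0 < x)
    (hy : 0 ≤ y) : morozovaChentsov f y x = morozovaChentsov f x y := by
  rw [hf.morozovaChentsov_eq hx hy, morozovaChentsov, if_neg hx.ne']

end IsRegularStandardMonotone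

/-! ### Algebra of unitary groups -/

namespace UnitaryGroup

variable {E : Type u} [NormedAddCommGroup E] [InnerProductSpace ℂ E] (G : UnitaryGroup E)

theorem U_zero (x : E) : G.U 0 x = x :=
  (G.U 0).injective (by rw [← G.map_add, add_zero])

theorem U_neg_U (t : ℝ) (x : E) : G.U (-t) (G.U t x) = x := by
  rw [← G.map_add, neg_add_cancel, G.U_zero]

theorem U_U_neg (t : ℝ) (x : E) : G.U t (G.U (-t) x) = x := by
  rw [← G.map_add, add_neg_cancel, G.U_zero]

theorem inner_U_left (t : ℝ) (x y : E) : ⟪G.U t x, y⟫_ℂ = ⟪x, G.U (-t) y⟫_ℂ := by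
  rw [← (G.U t).inner_map_map x, G.U_U_neg]

theorem inner_U_right (t : ℝ) (x y : E) : ⟪x, G.U t y⟫_ℂ = ⟪G.U (-t) x, y⟫_ℂ := by
  rw [G.inner_U_left, neg_neg]

end UnitaryGroup

end Asymmetry

namespace Asymmetry

/-! ### From the speed at time zero to overlaps at all times -/

namespace UnitaryGroup

variable {E : Type u} [NormedAddCommGroup E] [InnerProductSpace ℂ E] (G : UnitaryGroup E)

theorem norm_inner_U_le_one {χ : E} (hχ : ‖χ‖ = 1) (t : ℝ) : ‖⟪χ, G.U t χ⟫_ℂ‖ ≤ 1 := by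
  simpa [hχ] using norm_inner_le_norm (𝕜 := ℂ) χ (G.U t χ)

theorem norm_sub_smul_sq {x y : E} (hx : ‖x‖ = 1) (hy : ‖y‖ = 1) {c : ℂ} (hc : ‖c‖ = 1) :
    ‖y - c • x‖ ^ 2 = 2 - 2 * (c * ⟪y, x⟫_ℂ).re := by
  rw [@norm_sub_sq ℂ, norm_smul, hx, hy, hc, inner_smul_right]
  simp only [RCLike.re_to_complex]
  ring

/-- Up to a phase, the distance of two unit vectors is determined by their overlap. -/
theorem exists_phase {x y : E} (hx : ‖x‖ = 1) (hy : ‖y‖ = 1) :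
    ∃ c : ℂ, ‖c‖ = 1 ∧ ‖y - c • x‖ ^ 2 = 2 - 2 * ‖⟪x, y⟫_ℂ‖ := by
  obtain ⟨c, hc, h⟩ : ∃ c : ℂ, ‖c‖ = 1 ∧ c * ⟪y, x⟫_ℂ = ‖⟪x, y⟫_ℂ‖ := by
    by_cases h0 : ⟪y, x⟫_ℂ = 0
    · exact ⟨1, by simp, by rw [norm_inner_symm]; simp [h0]⟩
    · refine ⟨‖⟪y, x⟫_ℂ‖ / ⟪y, x⟫_ℂ, by simp [h0], ?_⟩
      rw [div_mul_cancel₀ _ h0, norm_inner_symm]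
  refine ⟨c, hc, ?_⟩
  rw [norm_sub_smul_sq hx hy hc, h, Complex.ofReal_re]

theorem two_sub_le_norm_sub_smul_sq {x y : E} (hx : ‖x‖ = 1) (hy : ‖y‖ = 1) {c : ℂ}
    (hc : ‖c‖ = 1) : 2 - 2 * ‖⟪x, y⟫_ℂ‖ ≤ ‖y - c • x‖ ^ 2 := by
  rw [norm_sub_smul_sq hx hy hc]
  have : (c * ⟪y, x⟫_ℂ).re ≤ ‖⟪x, y⟫_ℂ‖ := by
    refine (Complex.re_le_norm _).trans ?_
    rw [norm_mul, hc, one_mul, norm_inner_symm]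
  linarith

/-- Triangle inequality along `n` steps of length `s`: each step is isometric, so each adds the same
displacement modulo phase. -/
theorem norm_U_nat_mul_sub_le (χ : E) {c : ℂ} (hc : ‖c‖ = 1) (s : ℝ) (n : ℕ) :
    ‖G.U (n * s) χ - c ^ n • χ‖ ≤ n * ‖G.U s χ - c • χ‖ := by
  induction n with
  | zero => simp [G.U_zero]
  | succ n ih =>
    have e : G.U ((n + 1 : ℕ) * s) χ - c ^ (n + 1) • χ =
        G.U (n * s) (G.U s χ - c • χ) + c • (G.U (n * s) χ - c ^ n • χ) := by
      rw [_root_.map_sub, map_smul, ← G.map_add, smul_sub, smul_smul, pow_succ']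
      push_cast
      rw [add_mul, one_mul]
      abel
    rw [e]
    refine (norm_add_le _ _).trans ?_
    rw [LinearIsometryEquiv.norm_map, norm_smul, hc]
    push_cast
    linarith

theorem one_sub_norm_inner_nat_mul_le {χ : E} (hχ : ‖χ‖ = 1) (s : ℝ) (n : ℕ) :
    1 - ‖⟪χ, G.U (n * s) χ⟫_ℂ‖ ≤ n ^ 2 * (1 - ‖⟪χ, G.U s χ⟫_ℂ‖) := by
  obtain ⟨c, hc, h⟩ := exists_phase hχ (y := G.U s χ) (by simpa using hχ)
  have h1 := two_sub_le_norm_sub_smul_sq hχ (y := G.U (n * s) χ) (by simpa using hχ)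
    (c := c ^ n) (by simp [hc])
  have h2 := pow_le_pow_left₀ (norm_nonneg _) (G.norm_U_nat_mul_sub_le χ hc s n) 2
  rw [mul_pow, h] at h2
  linarith

/-- A bound on the speed at time zero bounds the evolution at all times. -/
theorem one_sub_norm_inner_sq_le_of_tendsto {χ : E} (hχ : ‖χ‖ = 1) {h : ℝ → ℝ} {K : ℝ}
    (hle : ∀ s, 1 - ‖⟪χ, G.U s χ⟫_ℂ‖ ^ 2 ≤ h s)
    (hlim : Tendsto (fun s => h s / s ^ 2) (𝓝[≠] 0) (𝓝 K)) (t : ℝ) :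
    1 - ‖⟪χ, G.U t χ⟫_ℂ‖ ^ 2 ≤ K * t ^ 2 := by
  rcases eq_or_ne t 0 with rfl | ht
  · simp [G.U_zero, hχ]
  set a : ℝ → ℝ := fun s => ‖⟪χ, G.U s χ⟫_ℂ‖ with ha
  have ha0 : Tendsto a (𝓝 0) (𝓝 1) := by
    have : Continuous a := (continuous_const.inner (G.continuous χ)).norm
    simpa [ha, G.U_zero, hχ] using this.tendsto 0
  have hseq : Tendsto (fun n : ℕ => t / n) atTop (𝓝[≠] 0) := by
    refine tendsto_nhdsWithin_iff.2 ⟨tendsto_const_div_atTop_nhds_zero_nat t, ?_⟩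
    filter_upwards [eventually_gt_atTop 0] with n hn
    exact div_ne_zero ht (by positivity)
  -- Subdivision into `n` steps bounds `1 - a`, not `1 - a²`. The factor `2 / (1 + a (t / n))` makes
  -- the conversion and tends to `1`.
  have hl : Tendsto (fun n : ℕ => t ^ 2 * (h (t / n) / (t / n) ^ 2) * (2 / (1 + a (t / n)))) atTop
      (𝓝 (t ^ 2 * K * (2 / (1 + 1)))) := by
    refine (tendsto_const_nhds.mul (hlim.comp hseq)).mul (tendsto_const_nhds.div
      (tendsto_const_nhds.add (ha0.comp (hseq.mono_right nhdsWithin_le_nhds))) (by norm_num))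
  have : 1 - a t ^ 2 ≤ t ^ 2 * K * (2 / (1 + 1)) := by
    refine ge_of_tendsto hl ?_
    filter_upwards [eventually_gt_atTop 0] with n hn
    have hn' : (0 : ℝ) < n := by positivity
    have h1 := G.one_sub_norm_inner_nat_mul_le hχ (t / n) n
    rw [mul_div_cancel₀ _ hn'.ne'] at h1
    have h2 := hle (t / n)
    have hn0 : 0 ≤ a (t / n) := norm_nonneg _
    have hnt : 0 ≤ a t := norm_nonneg _
    have hnt1 : a t ≤ 1 := G.norm_inner_U_le_one hχ t
    change 1 - a t ≤ n ^ 2 * (1 - a (t / n)) at h1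
    change 1 - a (t / n) ^ 2 ≤ h (t / n) at h2
    calc 1 - a t ^ 2 ≤ 2 * (1 - a t) := by nlinarith
      _ ≤ 2 * (n ^ 2 * (1 - a (t / n))) := by linarith
      _ = n ^ 2 * (1 - a (t / n) ^ 2) * (2 / (1 + a (t / n))) := by field_simp; ring
      _ ≤ n ^ 2 * h (t / n) * (2 / (1 + a (t / n))) := by gcongr
      _ = _ := by field_simp
  simpa [ha, mul_comm, show (1 : ℝ) + 1 = 2 by norm_num] using this

/-! ### Motion of a gapped top eigenvector -/

section Model

theorem unitaryModel_apply (ρ : E →L[ℂ] E) (t : ℝ) (x : E) :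
    unitaryModel G ρ t x = G.U t (ρ (G.U (-t) x)) := rfl

theorem unitaryModel_zero (ρ : E →L[ℂ] E) : unitaryModel G ρ 0 = ρ := by
  ext x
  simp [unitaryModel_apply, U_zero]

variable [CompleteSpace E]

theorem isSelfAdjoint_unitaryModel {ρ : E →L[ℂ] E} (hρ : IsSelfAdjoint ρ) (t : ℝ) :
    IsSelfAdjoint (unitaryModel G ρ t) := by
  rw [ContinuousLinearMap.isSelfAdjoint_iff_isSymmetric]
  intro x y
  change ⟪G.U t (ρ (G.U (-t) x)), y⟫_ℂ = ⟪x, G.U t (ρ (G.U (-t) y))⟫_ℂ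
  rw [G.inner_U_left, G.inner_U_right t x]
  exact hρ.isSymmetric.apply_clm _ _

theorem isSelfAdjoint_deriv_unitaryModel {ρ A : E →L[ℂ] E} (hρ : IsSelfAdjoint ρ)
    (hA : HasDerivAt (unitaryModel G ρ) A 0) : IsSelfAdjoint A := by
  have h := hA.star
  have e : (fun t => star (unitaryModel G ρ t)) = unitaryModel G ρ :=
    funext fun t => G.isSelfAdjoint_unitaryModel hρ t
  rw [e] at h
  exact h.unique hA

/-- If `χ` is a top eigenvector of `ρ` with spectral gap `g`, then the displacement of `χ` under
the evolution is controlled by the displacement of `ρ`. -/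
theorem gap_mul_le {ρ : E →L[ℂ] E} (hρ : IsSelfAdjoint ρ) {χ : E} (hχ : ‖χ‖ = 1) {l g : ℝ}
    (hl : ρ χ = (l : ℂ) • χ)
    (hgap : ∀ y, ⟪χ, y⟫_ℂ = 0 → (⟪y, ρ y⟫_ℂ).re ≤ (l - g) * ‖y‖ ^ 2) (s : ℝ) :
    ∃ w : E, ‖w‖ ^ 2 = 1 - ‖⟪χ, G.U s χ⟫_ℂ‖ ^ 2 ∧
      g * ‖w‖ ^ 2 ≤ (⟪χ, ρ χ - unitaryModel G ρ s χ⟫_ℂ).re ∧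
      g * ‖w‖ ^ 2 ≤ ‖w‖ * ‖unitaryModel G ρ s χ - ρ χ‖ := by
  set χs := G.U s χ with hχs
  have hns : ‖χs‖ = 1 := by simpa [hχs] using hχ
  set M := unitaryModel G ρ s with hM
  have hMs : IsSelfAdjoint M := G.isSelfAdjoint_unitaryModel hρ s
  have hMχ : M χs = (l : ℂ) • χs := by
    rw [hM, unitaryModel_apply, hχs, G.U_neg_U, hl, map_smul]
  -- `w` is the part of `χ` orthogonal to the evolved eigenvector `χs`. As `l - M` kills `χs`, the
  -- displacement `ρ χ - M χ` equals `(l - M) w`.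
  set w := χ - ⟪χs, χ⟫_ℂ • χs with hw
  have horth : ⟪χs, w⟫_ℂ = 0 := by
    simp [hw, hns]
  have horth' : ⟪w, χs⟫_ℂ = 0 := inner_eq_zero_symm.1 horth
  have hwn : ‖w‖ ^ 2 = 1 - ‖⟪χ, χs⟫_ℂ‖ ^ 2 := by
    have := norm_add_sq_eq_norm_sq_add_norm_sq_of_inner_eq_zero (𝕜 := ℂ) w (⟪χs, χ⟫_ℂ • χs)
      (by rw [inner_smul_right, horth', mul_zero])
    rw [hw, sub_add_cancel, ← hw, hχ, norm_smul, hns, norm_inner_symm] at this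
    nlinarith
  have hdiff : ρ χ - M χ = (l : ℂ) • w - M w := by
    rw [hl, hw, _root_.map_sub, map_smul, hMχ, smul_sub, smul_comm]
    abel
  -- The gap of `ρ` on the complement of `χ`, transported by the evolution, says that `l - M ≥ g` on
  -- the complement of `χs`.
  have hform : g * ‖w‖ ^ 2 ≤ (⟪w, ρ χ - M χ⟫_ℂ).re := by
    have h1 := hgap (G.U (-s) w) (by rw [← G.inner_U_left]; exact horth)
    rw [LinearIsometryEquiv.norm_map, ← G.inner_U_right s] at h1
    have h2 : (⟪w, M w⟫_ℂ).re ≤ (l - g) * ‖w‖ ^ 2 := h1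
    rw [hdiff, inner_sub_right, inner_smul_right, inner_self_eq_norm_sq_to_K, Complex.sub_re]
    have h3 : ((l : ℂ) * ((‖w‖ : ℝ) : ℂ) ^ 2).re = l * ‖w‖ ^ 2 := by norm_cast
    erw [h3]
    linarith
  refine ⟨w, hwn, ?_, ?_⟩
  · have e : ⟪χ, ρ χ - M χ⟫_ℂ = ⟪w, ρ χ - M χ⟫_ℂ := by
      rw [hdiff]
      nth_rewrite 1 [show χ = w + ⟪χs, χ⟫_ℂ • χs by rw [hw]; abel]
      rw [inner_add_left, add_eq_left, inner_smul_left, inner_sub_right, inner_smul_right, horth,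
        ← hMs.isSymmetric.apply_clm, hMχ, inner_smul_left, horth]
      simp
    rw [e]
    exact hform
  · rw [norm_sub_rev (unitaryModel G ρ s χ)]
    exact hform.trans ((Complex.re_le_norm _).trans (norm_inner_le_norm _ _))

/-- The expectation of the evolved state in `χ` is maximal at time zero, because `χ` is a top
eigenvector; so its derivative vanishes there. -/
theorem inner_deriv_unitaryModel_eq_zero {ρ A : E →L[ℂ] E} (hρ : IsSelfAdjoint ρ)
    (hA : HasDerivAt (unitaryModel G ρ) A 0) {χ : E} (hχ : ‖χ‖ = 1) {l g : ℝ} (hg : 0 ≤ g)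
    (hl : ρ χ = (l : ℂ) • χ)
    (hgap : ∀ y, ⟪χ, y⟫_ℂ = 0 → (⟪y, ρ y⟫_ℂ).re ≤ (l - g) * ‖y‖ ^ 2) :
    ⟪χ, A χ⟫_ℂ = 0 := by
  have hd : HasDerivAt (fun s => (⟪χ, unitaryModel G ρ s χ⟫_ℂ).re) (⟪χ, A χ⟫_ℂ).re 0 := by
    have h1 : HasDerivAt (fun s => unitaryModel G ρ s χ) (A χ) 0 := by
      exact (((ContinuousLinearMap.apply ℂ E χ).restrictScalars ℝ).hasFDerivAt.comp_hasDerivAt 0 hA)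
    have h2 := ((innerSL ℂ χ).restrictScalars ℝ).hasFDerivAt.comp_hasDerivAt 0 h1
    exact Complex.reCLM.hasFDerivAt.comp_hasDerivAt 0 h2
  have hmax : IsLocalMax (fun s => (⟪χ, unitaryModel G ρ s χ⟫_ℂ).re) 0 := by
    refine Eventually.of_forall fun s => ?_
    obtain ⟨w, -, h, -⟩ := G.gap_mul_le hρ hχ hl hgap s
    rw [inner_sub_right, Complex.sub_re] at h
    dsimp only
    rw [unitaryModel_zero]
    have : 0 ≤ g * ‖w‖ ^ 2 := by positivity
    linarith
  have hre := hmax.hasDerivAt_eq_zero hd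
  have hAs := G.isSelfAdjoint_deriv_unitaryModel hρ hA
  refine Complex.ext hre ?_
  have := hAs.isSymmetric.apply_clm χ χ
  rw [← inner_conj_symm] at this
  simpa using Complex.conj_eq_iff_im.1 this

/-- Speed limit: the evolution of a top eigenvector is bounded by the derivative of the state. -/
theorem one_sub_norm_inner_sq_le_of_hasDerivAt {ρ A : E →L[ℂ] E} (hρ : IsSelfAdjoint ρ)
    (hA : HasDerivAt (unitaryModel G ρ) A 0) {χ : E} (hχ : ‖χ‖ = 1) {l g : ℝ} (hg : 0 < g)
    (hl : ρ χ = (l : ℂ) • χ)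
    (hgap : ∀ y, ⟪χ, y⟫_ℂ = 0 → (⟪y, ρ y⟫_ℂ).re ≤ (l - g) * ‖y‖ ^ 2) (t : ℝ) :
    1 - ‖⟪χ, G.U t χ⟫_ℂ‖ ^ 2 ≤ ‖A χ‖ ^ 2 / g ^ 2 * t ^ 2 := by
  refine G.one_sub_norm_inner_sq_le_of_tendsto hχ
    (h := fun s => ‖unitaryModel G ρ s χ - ρ χ‖ ^ 2 / g ^ 2) (fun s => ?_) ?_ t
  · obtain ⟨w, hw, -, h⟩ := G.gap_mul_le hρ hχ hl hgap s
    rw [← hw, le_div_iff₀ (by positivity), ← mul_pow]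
    refine pow_le_pow_left₀ (by positivity) ?_ 2
    rcases (norm_nonneg w).eq_or_lt with h0 | h0
    · simp [← h0]
    · refine le_of_mul_le_mul_left ?_ h0
      linarith
  · have h1 : HasDerivAt (fun s => unitaryModel G ρ s χ) (A χ) 0 :=
      ((ContinuousLinearMap.apply ℂ E χ).restrictScalars ℝ).hasFDerivAt.comp_hasDerivAt 0 hA
    have h2 := ((hasDerivAt_iff_tendsto_slope_zero.1 h1).norm.pow 2).div_const (g ^ 2)
    refine h2.congr fun s => ?_
    simp only [zero_add, unitaryModel_zero, norm_smul, norm_inv, Real.norm_eq_abs, mul_pow, inv_pow,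
      sq_abs]
    ring

end Model

end UnitaryGroup

end Asymmetry

namespace Asymmetry

open UnitaryGroup

/-! ### Spectrum of a state near a pure state -/

section NearPure

variable {E : Type u} [NormedAddCommGroup E] [InnerProductSpace ℂ E]

theorem re_inner_pureState (φ y : E) : (⟪y, pureState φ y⟫_ℂ).re = ‖⟪φ, y⟫_ℂ‖ ^ 2 := by
  rw [pureState, InnerProductSpace.rankOne_apply, inner_smul_right, ← inner_conj_symm y φ,
    Complex.mul_conj, Complex.normSq_eq_norm_sq, Complex.ofReal_re]

theorem abs_norm_inner_sq_sub_le {φ : E} {σ : E →L[ℂ] E} {δ : ℝ} (h : ‖pureState φ - σ‖ ≤ δ)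
    (y : E) : |‖⟪φ, y⟫_ℂ‖ ^ 2 - (⟪y, σ y⟫_ℂ).re| ≤ δ * ‖y‖ ^ 2 := by
  rw [← re_inner_pureState, ← Complex.sub_re, ← inner_sub_right]
  calc |(⟪y, pureState φ y - σ y⟫_ℂ).re| ≤ ‖y‖ * ‖(pureState φ - σ) y‖ :=
        (Complex.abs_re_le_norm _).trans (norm_inner_le_norm _ _)
    _ ≤ ‖y‖ * (δ * ‖y‖) := by gcongr; exact (pureState φ - σ).le_of_opNorm_le h y
    _ = _ := by ring

theorem re_inner_eigenvector {σ : E →L[ℂ] E} {χ : E} {l : ℝ} (hl : σ χ = (l : ℂ) • χ) :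
    (⟪χ, σ χ⟫_ℂ).re = l * ‖χ‖ ^ 2 := by
  rw [hl, inner_smul_right, inner_self_eq_norm_sq_to_K, Complex.re_ofReal_mul]
  congr 1
  norm_cast

theorem eigenvalue_le_of_norm_sub_le {φ : E} (hφ : ‖φ‖ = 1) {σ : E →L[ℂ] E} {δ : ℝ}
    (h : ‖pureState φ - σ‖ ≤ δ) {χ : E} (hχ : ‖χ‖ = 1) {l : ℝ} (hl : σ χ = (l : ℂ) • χ) :
    l ≤ ‖⟪χ, φ⟫_ℂ‖ ^ 2 + δ ∧ ‖⟪χ, φ⟫_ℂ‖ ≤ 1 := by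
  have h1 := abs_norm_inner_sq_sub_le h χ
  rw [re_inner_eigenvector hl, hχ, norm_inner_symm, abs_le] at h1
  exact ⟨by linarith, by simpa [hφ, hχ] using norm_inner_le_norm (𝕜 := ℂ) χ φ⟩

/-- A vector orthogonal to `χ` sees only the part `z` of `φ` orthogonal to `χ`, and `‖z‖² ≤ 2δ`;
passing from the pure state to `σ` costs another `δ`. -/
theorem re_inner_le_of_orthogonal {φ : E} (hφ : ‖φ‖ = 1) {σ : E →L[ℂ] E} {δ : ℝ}
    (h : ‖pureState φ - σ‖ ≤ δ) {χ : E} (hχ : ‖χ‖ = 1) (hov : 1 - 2 * δ ≤ ‖⟪χ, φ⟫_ℂ‖ ^ 2)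
    {y : E} (hy : ⟪χ, y⟫_ℂ = 0) : (⟪y, σ y⟫_ℂ).re ≤ 3 * δ * ‖y‖ ^ 2 := by
  set z := φ - ⟪χ, φ⟫_ℂ • χ with hz
  have hzχ : ⟪z, χ⟫_ℂ = 0 := by
    simp [hz, hχ]
  have hzn : ‖z‖ ^ 2 = 1 - ‖⟪χ, φ⟫_ℂ‖ ^ 2 := by
    have := norm_add_sq_eq_norm_sq_add_norm_sq_of_inner_eq_zero (𝕜 := ℂ) z (⟪χ, φ⟫_ℂ • χ)
      (by rw [inner_smul_right, hzχ, mul_zero])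
    rw [hz, sub_add_cancel, ← hz, hφ, norm_smul, hχ] at this
    nlinarith
  have hzy : ⟪φ, y⟫_ℂ = ⟪z, y⟫_ℂ := by
    rw [hz, inner_sub_left, inner_smul_left, hy, mul_zero, sub_zero]
  have h1 := abs_norm_inner_sq_sub_le h y
  have h2 : ‖⟪φ, y⟫_ℂ‖ ^ 2 ≤ ‖z‖ ^ 2 * ‖y‖ ^ 2 := by
    rw [hzy, ← mul_pow]
    gcongr
    exact norm_inner_le_norm _ _
  rw [abs_le] at h1
  nlinarith [sq_nonneg ‖y‖]

/-- `⟨φ, σ φ⟩ ≥ 1 - δ` is the average of the eigenvalues with weights `|⟨b i, φ⟩|²`, so they cannot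
all be smaller. -/
theorem exists_eigenvalue_ge {φ : E} (hφ : ‖φ‖ = 1) {σ : E →L[ℂ] E} {δ : ℝ}
    [CompleteSpace E] (hσ : IsSelfAdjoint σ)
    (h : ‖pureState φ - σ‖ ≤ δ) {ι : Type*} (b : HilbertBasis ι ℂ E) (l : ι → ℝ)
    (hl : ∀ i, σ (b i) = (l i : ℂ) • b i) : ∃ i, 1 - δ ≤ l i := by
  by_contra! hlt
  have h1 := abs_norm_inner_sq_sub_le h φ
  rw [inner_self_eq_norm_sq_to_K, hφ] at h1
  have h2 : HasSum (fun i => l i * ‖⟪b i, φ⟫_ℂ‖ ^ 2) (⟪φ, σ φ⟫_ℂ).re := by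
    have := (b.hasSum_inner_mul_inner φ (σ φ)).mapL Complex.reCLM
    simp only [Complex.reCLM_apply] at this
    refine this.congr_fun fun i => ?_
    rw [← hσ.isSymmetric.apply_clm, hl, inner_smul_left, Complex.conj_ofReal,
      mul_left_comm, Complex.re_ofReal_mul, ← inner_conj_symm φ (b i),
      ← Complex.normSq_eq_conj_mul_self, Complex.ofReal_re, Complex.normSq_eq_norm_sq]
  have h3 := (hasSum_norm_inner_sq b φ).mul_left (1 - δ)
  obtain ⟨i, hi⟩ : ∃ i, ⟪b i, φ⟫_ℂ ≠ 0 := by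
    by_contra! h0
    have := (hasSum_norm_inner_sq b φ).tsum_eq
    simp [h0, hφ] at this
  have h4 := hasSum_lt (i := i) (fun j => mul_le_mul_of_nonneg_right (hlt j).le (by positivity))
    (mul_lt_mul_of_pos_right (hlt i) (by positivity)) h2 h3
  rw [hφ] at h4
  rw [abs_le] at h1
  norm_num at h1 h4
  linarith

/-- Up to a phase `χ` is within `2√δ` of `φ`. Each of the two slots of the overlap costs `2√δ`, and
squaring numbers in `[0, 1]` doubles the error. The bound is uniform in `t`. -/
theorem norm_inner_U_sq_le (G : UnitaryGroup E) {φ χ : E} (hφ : ‖φ‖ = 1) (hχ : ‖χ‖ = 1) {δ : ℝ}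
    (hov : 1 - 2 * δ ≤ ‖⟪χ, φ⟫_ℂ‖ ^ 2) (t : ℝ) :
    ‖⟪χ, G.U t χ⟫_ℂ‖ ^ 2 ≤ ‖⟪φ, G.U t φ⟫_ℂ‖ ^ 2 + 8 * √δ := by
  obtain ⟨c, hc, h⟩ := exists_phase hχ hφ
  have hov1 : ‖⟪χ, φ⟫_ℂ‖ ≤ 1 := by simpa [hφ, hχ] using norm_inner_le_norm (𝕜 := ℂ) χ φ
  have hd : ‖φ - c • χ‖ ≤ 2 * √δ := by
    have : ‖φ - c • χ‖ ^ 2 ≤ 4 * δ := by nlinarith [norm_nonneg ⟪χ, φ⟫_ℂ]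
    rw [show (2 : ℝ) * √δ = √(4 * δ) by
      rw [Real.sqrt_mul (by norm_num), show (4 : ℝ) = 2 ^ 2 by norm_num, Real.sqrt_sq (by norm_num)]]
    exact Real.le_sqrt_of_sq_le this
  have e1 : ‖⟪χ, G.U t χ⟫_ℂ‖ = ‖⟪c • χ, G.U t (c • χ)⟫_ℂ‖ := by
    rw [map_smul, inner_smul_left, inner_smul_right, norm_mul, norm_mul, RCLike.norm_conj, hc]
    ring
  have e2 : ⟪c • χ, G.U t (c • χ)⟫_ℂ =
      ⟪φ, G.U t φ⟫_ℂ - ⟪φ - c • χ, G.U t φ⟫_ℂ - ⟪c • χ, G.U t (φ - c • χ)⟫_ℂ := by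
    rw [_root_.map_sub, inner_sub_left, inner_sub_right]
    ring
  have h1 : ‖⟪φ - c • χ, G.U t φ⟫_ℂ‖ ≤ 2 * √δ := by
    refine (norm_inner_le_norm _ _).trans ?_
    rwa [LinearIsometryEquiv.norm_map, hφ, mul_one]
  have h2 : ‖⟪c • χ, G.U t (φ - c • χ)⟫_ℂ‖ ≤ 2 * √δ := by
    refine (norm_inner_le_norm _ _).trans ?_
    rwa [LinearIsometryEquiv.norm_map, norm_smul, hc, hχ, one_mul, one_mul]
  have h3 : ‖⟪χ, G.U t χ⟫_ℂ‖ ≤ ‖⟪φ, G.U t φ⟫_ℂ‖ + 4 * √δ := by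
    rw [e1, e2]
    refine (norm_sub_le _ _).trans ?_
    have := norm_sub_le ⟪φ, G.U t φ⟫_ℂ ⟪φ - c • χ, G.U t φ⟫_ℂ
    linarith
  have h4 := G.norm_inner_U_le_one hχ t
  have h5 := G.norm_inner_U_le_one hφ t
  nlinarith [norm_nonneg ⟪χ, G.U t χ⟫_ℂ, norm_nonneg ⟪φ, G.U t φ⟫_ℂ, Real.sqrt_nonneg δ]

end NearPure

/-! ### Lower bound on the skew information near a pure state -/

section LowerBound

variable {E : Type u} [NormedAddCommGroup E] [InnerProductSpace ℂ E] [CompleteSpace E]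

/-- Sums the row and column through `i₀`. The corner is counted twice, which is harmless when `u i₀
= 0`, as in both applications. -/
theorem tsum_cross {ι : Type*} [DecidableEq ι] (i₀ : ι) (u : ι → ℝ≥0∞) :
    ∑' (i : ι) (j : ι), ((if i = i₀ then u j else 0) + (if j = i₀ then u i else 0)) =
      2 * ∑' i, u i := by
  simp_rw [ENNReal.tsum_add, tsum_ite_eq]
  rw [two_mul]
  congr 1
  rw [ENNReal.tsum_comm]
  simp_rw [tsum_ite_eq]

/-- The factor lost in bounding the skew information of a state at distance `δ` (in operator norm)
of a pure state. -/
noncomputable def smoothingFactor (f : ℝ → ℝ) (δ : ℝ) : ℝ :=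
  f 0 * (1 - 4 * δ) ^ 2 / ((1 + δ) * f (3 * δ / (1 - δ)))

theorem smoothingFactor_zero {f : ℝ → ℝ} (hf : IsRegularStandardMonotone f) :
    smoothingFactor f 0 = 1 := by
  simp [smoothingFactor, hf.regular]

theorem smoothingFactor_nonneg {f : ℝ → ℝ} (hf : IsRegularStandardMonotone f) {δ : ℝ}
    (hδ : 0 ≤ δ) (hδ1 : δ < 1) : 0 ≤ smoothingFactor f δ := by
  have h1 := hf.zero_pos
  have h2 := hf.pos_of_nonneg (x := 3 * δ / (1 - δ)) (div_nonneg (by positivity) (by linarith))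
  unfold smoothingFactor
  positivity

theorem tendsto_smoothingFactor {f : ℝ → ℝ} (hf : IsRegularStandardMonotone f) :
    Tendsto (smoothingFactor f) (𝓝[>] 0) (𝓝 1) := by
  have hid : Tendsto (fun δ : ℝ => δ) (𝓝[>] 0) (𝓝 0) := nhdsWithin_le_nhds
  have h1 : Tendsto (fun δ : ℝ => 3 * δ / (1 - δ)) (𝓝[>] 0) (𝓝[≥] 0) := by
    refine tendsto_nhdsWithin_iff.2 ⟨?_, ?_⟩
    · simpa [Pi.div_def] using (hid.const_mul 3).div
        (tendsto_const_nhds (x := (1 : ℝ)).sub hid) (by norm_num)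
    · filter_upwards [Ioo_mem_nhdsGT (show (0 : ℝ) < 1 by norm_num)] with δ hδ
      have h0 : 0 < δ := hδ.1
      have h1 : δ < 1 := hδ.2
      exact Set.mem_Ici.2 (div_nonneg (by linarith) (by linarith))
  have h2 : Tendsto (fun δ : ℝ => f (3 * δ / (1 - δ))) (𝓝[>] 0) (𝓝 (f 0)) :=
    Tendsto.comp hf.continuous_zero h1
  have h3 := ((((tendsto_const_nhds (x := (1 : ℝ))).sub (hid.const_mul 4)).pow 2).const_mul
    (f 0)).div (((tendsto_const_nhds (x := (1 : ℝ))).add hid).mul h2) (by simpa using hf.regular)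
  have e : f 0 * (1 - 4 * 0) ^ 2 / ((1 + 0) * f 0) = 1 := by simp [hf.regular]
  rw [e] at h3
  exact h3

/-- Of the double sum only the row and column of the top eigenvector are kept. By Parseval they
contribute at least `2 C ‖A χ‖²`, and the speed limit bounds `‖A χ‖` below. -/
theorem le_monotoneMetric {f : ℝ → ℝ} (hf : IsRegularStandardMonotone f) (G : UnitaryGroup E)
    {φ : E} (hφ : ‖φ‖ = 1) {σ : E →L[ℂ] E} (hσ : σ.IsPositive) {δ : ℝ} (hδ : 0 ≤ δ)
    (hδ4 : δ < 1 / 4) (h : ‖pureState φ - σ‖ ≤ δ) {A : E →L[ℂ] E}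
    (hA : HasDerivAt (unitaryModel G σ) A 0) {t : ℝ} (ht : 0 < t) :
    2 * ENNReal.ofReal (((1 + δ) * f (3 * δ / (1 - δ)))⁻¹ * ((1 - 4 * δ) ^ 2 *
      ((1 - ‖⟪φ, G.U t φ⟫_ℂ‖ ^ 2 - 8 * √δ) / t ^ 2))) ≤ monotoneMetric f σ A := by
  classical
  refine le_iInf fun s => le_iInf fun b => le_iInf fun l => le_iInf fun hl => ?_
  have hσs : IsSelfAdjoint σ := hσ.isSelfAdjoint
  obtain ⟨i₀, hi₀⟩ := exists_eigenvalue_ge hφ hσs h b l hl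
  have hb : ∀ i, ‖b i‖ = 1 := fun i => b.orthonormal.1 i
  obtain ⟨hle, hov1⟩ := eigenvalue_le_of_norm_sub_le hφ h (hb i₀) (hl i₀)
  have hov : 1 - 2 * δ ≤ ‖⟪b i₀, φ⟫_ℂ‖ ^ 2 := by linarith
  have hl0 : 0 < l i₀ := by linarith
  have hl1 : l i₀ ≤ 1 + δ := by nlinarith [norm_nonneg ⟪b i₀, φ⟫_ℂ]
  have hg : 0 < 1 - 4 * δ := by linarith
  have hgap : ∀ y, ⟪b i₀, y⟫_ℂ = 0 → (⟪y, σ y⟫_ℂ).re ≤ (l i₀ - (1 - 4 * δ)) * ‖y‖ ^ 2 := by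
    intro y hy
    refine (re_inner_le_of_orthogonal hφ h (hb i₀) hov hy).trans ?_
    gcongr
    linarith
  have hdiag := G.inner_deriv_unitaryModel_eq_zero hσs hA (hb i₀) hg.le (hl i₀) hgap
  have hspeed := G.one_sub_norm_inner_sq_le_of_hasDerivAt hσs hA (hb i₀) hg (hl i₀) hgap t
  have hAs := G.isSelfAdjoint_deriv_unitaryModel hσs hA
  set C := ((1 + δ) * f (3 * δ / (1 - δ)))⁻¹ with hC
  have hfpos := hf.pos_of_nonneg (x := 3 * δ / (1 - δ)) (div_nonneg (by positivity) (by linarith))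
  have hCnn : 0 ≤ C := by positivity
  -- `C` comes from `1 - δ ≤ l i₀ ≤ 1 + δ` and `l j ≤ 3δ`, as `f` is increasing.
  have hcoef : ∀ j, j ≠ i₀ → C ≤ morozovaChentsov f (l i₀) (l j) ∧
      C ≤ morozovaChentsov f (l j) (l i₀) := by
    intro j hj
    have hort : ⟪b i₀, b j⟫_ℂ = 0 := b.orthonormal.2 hj.symm
    have hlj : l j ≤ 3 * δ := by
      have := re_inner_le_of_orthogonal hφ h (hb i₀) hov hort
      rwa [re_inner_eigenvector (hl j), hb j, one_pow, mul_one, mul_one] at this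
    have hlj0 : 0 ≤ l j := by
      have := hσ.re_inner_nonneg_right (b j)
      rw [RCLike.re_to_complex, re_inner_eigenvector (hl j), hb j] at this
      simpa using this
    rw [hf.morozovaChentsov_comm hl0 hlj0, and_self, hf.morozovaChentsov_eq hl0 hlj0]
    have hq : 0 ≤ l j / l i₀ := by positivity
    have hfq := hf.pos_of_nonneg hq
    have h1δ : 0 < 1 - δ := by linarith
    have hmono : f (l j / l i₀) ≤ f (3 * δ / (1 - δ)) :=
      hf.monotoneOn hq (hq.trans (by gcongr)) (by gcongr)
    rw [hC]
    gcongr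
  set u : s → ℝ≥0∞ := fun j => ENNReal.ofReal C * ‖⟪b j, A (b i₀)⟫_ℂ‖ₑ ^ 2 with hu
  have husum : ∑' i, u i = ENNReal.ofReal (C * ‖A (b i₀)‖ ^ 2) := by
    rw [hu, ENNReal.tsum_mul_left, tsum_enorm_inner_sq, enorm_sq_eq_ofReal, ENNReal.ofReal_mul hCnn]
  have hu0 : u i₀ = 0 := by simp [hu, hdiag]
  have hsymm : ∀ j, ‖⟪b i₀, A (b j)⟫_ℂ‖ₑ = ‖⟪b j, A (b i₀)⟫_ℂ‖ₑ := by
    intro j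
    rw [← ofReal_norm, ← ofReal_norm, ← hAs.isSymmetric.apply_clm, norm_inner_symm]
  calc 2 * ENNReal.ofReal (C * ((1 - 4 * δ) ^ 2 *
        ((1 - ‖⟪φ, G.U t φ⟫_ℂ‖ ^ 2 - 8 * √δ) / t ^ 2)))
      ≤ 2 * ENNReal.ofReal (C * ‖A (b i₀)‖ ^ 2) := by
        gcongr
        have h1 := norm_inner_U_sq_le G hφ (hb i₀) hov t
        rw [div_mul_eq_mul_div, le_div_iff₀ (by positivity)] at hspeed
        rw [← mul_div_assoc, div_le_iff₀ (by positivity)]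
        nlinarith [sq_nonneg (1 - 4 * δ)]
    _ = ∑' (i : s) (j : s), ((if i = i₀ then u j else 0) + (if j = i₀ then u i else 0)) := by
        rw [tsum_cross, husum]
    _ ≤ _ := by
        refine ENNReal.tsum_le_tsum fun i => ENNReal.tsum_le_tsum fun j => ?_
        by_cases hi : i = i₀ <;> by_cases hj : j = i₀
        · subst hi
          simp [hj, hu0]
        · subst hi
          simp only [if_true, hj, if_false, add_zero, hu]
          rw [hsymm]
          gcongr
          exact (hcoef j hj).1
        · subst hj
          simp only [if_true, hi, if_false, zero_add, hu]
          gcongr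
          exact (hcoef i hi).2
        · simp [hi, hj]

/-- A lower bound for the skew information of all states near a pure state. -/
theorem le_skewInfo {f : ℝ → ℝ} (hf : IsRegularStandardMonotone f) (G : UnitaryGroup E)
    {φ : E} (hφ : ‖φ‖ = 1) {σ : E →L[ℂ] E} (hσ : σ.IsPositive) {δ : ℝ} (hδ : 0 ≤ δ)
    (hδ4 : δ < 1 / 4) (h : ‖pureState φ - σ‖ ≤ δ) {t : ℝ} (ht : 0 < t) :
    ENNReal.ofReal (smoothingFactor f δ * ((1 - ‖⟪φ, G.U t φ⟫_ℂ‖ ^ 2 - 8 * √δ) / t ^ 2)) ≤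
      skewInfo f G σ := by
  have hf0 := hf.zero_pos
  unfold skewInfo quantumFisher
  split_ifs with hd
  · rw [unitaryModel_zero]
    refine le_trans (le_of_eq ?_) (mul_le_mul_right
      (le_monotoneMetric hf G hφ hσ hδ hδ4 h hd.hasDerivAt ht) _)
    rw [show (2 : ℝ≥0∞) = ENNReal.ofReal 2 by simp, ← ENNReal.ofReal_mul (by norm_num),
      ← ENNReal.ofReal_mul (by positivity)]
    congr 1
    unfold smoothingFactor
    ring
  · rw [ENNReal.mul_top (by simpa using hf0)]
    exact le_top

end LowerBound

end Asymmetry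

namespace Asymmetry

open UnitaryGroup

/-! ### Finite second moment puts the state in the domain of the Hamiltonian -/

section Domain

variable {E : Type u} [NormedAddCommGroup E] [InnerProductSpace ℂ E]

/-- The difference quotient at zero of `exp (-i t x)`. -/
noncomputable def phaseSlope (t x : ℝ) : ℂ := (t : ℂ)⁻¹ * (Complex.exp (-(Complex.I * t * x)) - 1)

theorem norm_phaseSlope_le (t x : ℝ) : ‖phaseSlope t x‖ ≤ |x| := by
  rcases eq_or_ne t 0 with rfl | ht
  · simp [phaseSlope]
  rw [phaseSlope, norm_mul, norm_inv, Complex.norm_real, Real.norm_eq_abs]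
  have h := Real.norm_exp_I_mul_ofReal_sub_one_le (x := -(t * x))
  rw [show Complex.I * ((-(t * x) : ℝ) : ℂ) = -(Complex.I * t * x) by push_cast; ring] at h
  rw [inv_mul_le_iff₀ (by positivity)]
  refine h.trans ?_
  rw [Real.norm_eq_abs, abs_neg, abs_mul]

theorem tendsto_phaseSlope (x : ℝ) :
    Tendsto (fun t => phaseSlope t x) (𝓝[≠] 0) (𝓝 (-(Complex.I * x))) := by
  have h1 : HasDerivAt (fun t : ℝ => -(Complex.I * t * x)) (-(Complex.I * 1 * x)) 0 :=
    ((((hasDerivAt_id (0 : ℝ)).ofReal_comp).const_mul Complex.I).mul_const (x : ℂ)).neg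
  have h2 := hasDerivAt_iff_tendsto_slope_zero.1 h1.cexp
  refine (h2.congr fun t => ?_).trans_eq ?_
  · simp [phaseSlope]
  · simp

theorem continuous_phaseSlope (t : ℝ) : Continuous (phaseSlope t) := by
  unfold phaseSlope
  fun_prop

theorem integrable_exp_neg_I {μ : Measure ℝ} [IsFiniteMeasure μ] (t : ℝ) :
    Integrable (fun x : ℝ => Complex.exp (-(Complex.I * t * x))) μ := by
  refine Integrable.of_bound (C := 1) (by fun_prop) (Eventually.of_forall fun x => ?_)
  rw [Complex.norm_exp]
  simp

/-- The correspondence of `U_t ψ` with `exp(-i t x)` in `L²(μ)` preserves inner products. Expanding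
them needs only the characteristic function of `μ`, not the spectral theorem. -/
theorem inner_slope_slope [CompleteSpace E] {G : UnitaryGroup E} {ψ : E} {μ : Measure ℝ}
    (hμ : IsEnergyDistribution G ψ μ) (s t : ℝ) :
    ⟪s⁻¹ • (G.U s ψ - ψ), t⁻¹ • (G.U t ψ - ψ)⟫_ℂ =
      ∫ x, starRingEnd ℂ (phaseSlope s x) * phaseSlope t x ∂μ := by
  obtain ⟨hprob, hchar⟩ := hμ
  have e : ∀ x : ℝ, starRingEnd ℂ (phaseSlope s x) * phaseSlope t x =
      ((s : ℂ)⁻¹ * (t : ℂ)⁻¹) * (Complex.exp (-(Complex.I * (t - s : ℝ) * x)) -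
        Complex.exp (-(Complex.I * (-s : ℝ) * x)) - (Complex.exp (-(Complex.I * t * x)) -
          Complex.exp (-(Complex.I * (0 : ℝ) * x)))) := by
    intro x
    have h1 : starRingEnd ℂ (Complex.exp (-(Complex.I * s * x))) =
        Complex.exp (-(Complex.I * (-s : ℝ) * x)) := by
      rw [← Complex.exp_conj]
      simp
    have h2 : Complex.exp (-(Complex.I * (t - s : ℝ) * x)) =
        Complex.exp (-(Complex.I * (-s : ℝ) * x)) * Complex.exp (-(Complex.I * t * x)) := by
      rw [← Complex.exp_add]
      congr 1
      push_cast
      ring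
    rw [phaseSlope, phaseSlope, _root_.map_mul, _root_.map_sub, h1, h2]
    simp only [map_inv₀, Complex.conj_ofReal, _root_.map_one, Complex.ofReal_zero, mul_zero,
      zero_mul, neg_zero, Complex.exp_zero]
    ring
  simp_rw [e]
  have hi : ∀ r : ℝ, Integrable (fun x : ℝ => Complex.exp (-(Complex.I * r * x))) μ :=
    fun r => integrable_exp_neg_I r
  have hi2 : ∀ r q : ℝ, Integrable (fun x : ℝ => Complex.exp (-(Complex.I * r * x)) -
      Complex.exp (-(Complex.I * q * x))) μ := fun r q => (hi r).sub (hi q)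
  rw [integral_const_mul, integral_sub (hi2 _ _) (hi2 _ _),
    integral_sub (hi _) (hi _), integral_sub (hi _) (hi _), hchar, hchar, hchar, hchar]
  rw [← Complex.coe_smul, ← Complex.coe_smul, inner_smul_left, inner_smul_right, inner_sub_left,
    inner_sub_right, inner_sub_right, G.U_zero, G.inner_U_left s ψ (G.U t ψ), ← G.map_add,
    G.inner_U_left s ψ ψ, show -s + t = t - s by ring]
  simp only [Complex.ofReal_inv, map_inv₀, Complex.conj_ofReal]
  ring

theorem tendsto_inner_slope_slope [CompleteSpace E] {G : UnitaryGroup E} {ψ : E} {μ : Measure ℝ}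
    (hμ : IsEnergyDistribution G ψ μ) (hint : Integrable (fun x : ℝ => |x| ^ 2) μ) :
    Tendsto (fun p : ℝ × ℝ => ⟪p.1⁻¹ • (G.U p.1 ψ - ψ), p.2⁻¹ • (G.U p.2 ψ - ψ)⟫_ℂ)
      (𝓝[≠] 0 ×ˢ 𝓝[≠] 0)
      (𝓝 (∫ x : ℝ, starRingEnd ℂ (-(Complex.I * x)) * (-(Complex.I * x)) ∂μ)) := by
  simp_rw [inner_slope_slope hμ]
  refine tendsto_integral_filter_of_dominated_convergence (fun x => |x| ^ 2)
    (Eventually.of_forall fun p => ?_) (Eventually.of_forall fun p => ?_) hint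
    (Eventually.of_forall fun x => ?_)
  · exact ((Complex.continuous_conj.comp (continuous_phaseSlope _)).mul
      (continuous_phaseSlope _)).aestronglyMeasurable
  · refine Eventually.of_forall fun x => ?_
    rw [norm_mul, RCLike.norm_conj, pow_two]
    exact mul_le_mul (norm_phaseSlope_le _ _) (norm_phaseSlope_le _ _) (norm_nonneg _)
      (abs_nonneg _)
  · exact ((Complex.continuous_conj.tendsto _).comp
      ((tendsto_phaseSlope x).comp tendsto_fst)).mul ((tendsto_phaseSlope x).comp tendsto_snd)

/-- A state with finite second moment of the energy lies in the domain of the Hamiltonian. -/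
theorem differentiableAt_of_finiteAbsMoment_two [CompleteSpace E] {G : UnitaryGroup E} {ψ : E}
    (h : FiniteAbsMoment G ψ 2) : DifferentiableAt ℝ (fun t : ℝ => G.U t ψ) 0 := by
  obtain ⟨μ, hμ, hint⟩ := h
  set D : ℝ → E := fun t => t⁻¹ • (G.U t ψ - ψ) with hD
  have hF := tendsto_inner_slope_slope hμ hint
  set l : Filter ℝ := 𝓝[≠] 0 with hl
  have h11 := hF.comp (tendsto_fst.prodMk tendsto_fst : Tendsto (fun p : ℝ × ℝ => (p.1, p.1))
    (l ×ˢ l) (l ×ˢ l))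
  have h22 := hF.comp (tendsto_snd.prodMk tendsto_snd : Tendsto (fun p : ℝ × ℝ => (p.2, p.2))
    (l ×ˢ l) (l ×ˢ l))
  have h21 := hF.comp (tendsto_snd.prodMk tendsto_fst : Tendsto (fun p : ℝ × ℝ => (p.2, p.1))
    (l ×ˢ l) (l ×ˢ l))
  -- All four inner products in the expanded square have the same joint limit, so they cancel and
  -- the difference quotients are Cauchy.
  have hsq : Tendsto (fun p : ℝ × ℝ => ‖D p.1 - D p.2‖ ^ 2) (l ×ˢ l) (𝓝 0) := by
    have := (Complex.continuous_re.tendsto _).comp ((h11.sub hF).sub (h21.sub h22))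
    refine (this.congr fun p => ?_).trans_eq (by simp)
    simp only [Function.comp_apply]
    rw [← inner_self_eq_norm_sq (𝕜 := ℂ), inner_sub_left, inner_sub_right, inner_sub_right]
    rfl
  have hdist : Tendsto (fun p : ℝ × ℝ => dist (D p.1) (D p.2)) (l ×ˢ l) (𝓝 0) := by
    have := (Real.continuous_sqrt.tendsto 0).comp hsq
    rw [Real.sqrt_zero] at this
    refine this.congr fun p => ?_
    rw [Function.comp_apply, Real.sqrt_sq (norm_nonneg _), dist_eq_norm]
  have hcauchy : Cauchy (map D l) :=
    cauchy_map_iff'.2 (tendsto_uniformity_iff_dist_tendsto_zero.2 hdist)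
  obtain ⟨v, hv⟩ := CompleteSpace.complete hcauchy
  have : HasDerivAt (fun t : ℝ => G.U t ψ) v 0 := by
    rw [hasDerivAt_iff_tendsto_slope_zero]
    simp only [zero_add, G.U_zero]
    exact hv
  exact this.differentiableAt

theorem FiniteAbsMoment.two_of_three [CompleteSpace E] {G : UnitaryGroup E} {ψ : E}
    (h : FiniteAbsMoment G ψ 3) : FiniteAbsMoment G ψ 2 := by
  obtain ⟨μ, hμ, hint⟩ := h
  have := hμ.1
  refine ⟨μ, hμ, (hint.add (integrable_const 1)).mono' (by fun_prop)
    (Eventually.of_forall fun x => ?_)⟩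
  rw [Real.norm_of_nonneg (by positivity), Pi.add_apply]
  nlinarith [abs_nonneg x, mul_nonneg (abs_nonneg x) (sq_nonneg (|x| - 1)), sq_nonneg (|x| - 1)]

end Domain

/-! ### Skew information of pure states -/

section Pure

variable {E : Type u} [NormedAddCommGroup E] [InnerProductSpace ℂ E]

theorem isBoundedBilinearMap_rankOne :
    IsBoundedBilinearMap ℝ (fun p : E × E => InnerProductSpace.rankOne ℂ p.1 p.2) where
  add_left x x' y := by simp
  add_right x y y' := by simp
  smul_left c x y := by ext; simp [← Complex.coe_smul, smul_smul]
  smul_right c x y := by ext; simp [← Complex.coe_smul, smul_smul]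
  bound := ⟨1, one_pos, fun x y => by simp⟩

theorem unitaryModel_pureState (G : UnitaryGroup E) (χ : E) (t : ℝ) :
    unitaryModel G (pureState χ) t = InnerProductSpace.rankOne ℂ (G.U t χ) (G.U t χ) := by
  ext x
  rw [unitaryModel_apply, pureState, InnerProductSpace.rankOne_apply,
    InnerProductSpace.rankOne_apply, map_smul, G.inner_U_left]

theorem hasDerivAt_unitaryModel_pureState (G : UnitaryGroup E) {χ v : E}
    (hv : HasDerivAt (fun t : ℝ => G.U t χ) v 0) :
    HasDerivAt (unitaryModel G (pureState χ))
      (InnerProductSpace.rankOne ℂ χ v + InnerProductSpace.rankOne ℂ v χ) 0 := by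
  have h := (isBoundedBilinearMap_rankOne (E := E)).hasFDerivAt
    (G.U 0 χ, G.U 0 χ) |>.comp_hasDerivAt (0 : ℝ) (hv.prodMk hv)
  simp only [G.U_zero] at h
  exact h.congr_of_eventuallyEq (Eventually.of_forall fun t => unitaryModel_pureState G χ t)

theorem re_inner_deriv_eq_zero (G : UnitaryGroup E) {χ v : E}
    (hv : HasDerivAt (fun t : ℝ => G.U t χ) v 0) : (⟪χ, v⟫_ℂ).re = 0 := by
  have h := (HasDerivAt.inner ℂ hv hv)
  have h0 : HasDerivAt (fun t : ℝ => ⟪G.U t χ, G.U t χ⟫_ℂ) 0 0 := by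
    simp only [LinearIsometryEquiv.inner_map_map]
    exact hasDerivAt_const _ _
  have e := congrArg Complex.re (h.unique h0)
  rw [G.U_zero, ← inner_conj_symm v χ, Complex.add_re, Complex.conj_re] at e
  simp only [Complex.zero_re] at e
  linarith

theorem norm_sub_inner_smul_sq {χ : E} (hχ : ‖χ‖ = 1) (x : E) :
    ‖x - ⟪χ, x⟫_ℂ • χ‖ ^ 2 = ‖x‖ ^ 2 - ‖⟪χ, x⟫_ℂ‖ ^ 2 := by
  have h0 : ⟪x - ⟪χ, x⟫_ℂ • χ, χ⟫_ℂ = 0 := by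
    rw [inner_sub_left, inner_smul_left, inner_self_eq_norm_sq_to_K, hχ, inner_conj_symm]
    simp
  have := norm_add_sq_eq_norm_sq_add_norm_sq_of_inner_eq_zero (𝕜 := ℂ) (x - ⟪χ, x⟫_ℂ • χ)
    (⟪χ, x⟫_ℂ • χ) (by rw [inner_smul_right, h0, mul_zero])
  rw [sub_add_cancel, norm_smul, hχ] at this
  nlinarith

/-- The numerator is the squared norm of the part of `U_t χ` orthogonal to `χ`, which is `t` times
the orthogonal part of the difference quotient. -/
theorem tendsto_one_sub_norm_inner_sq_div (G : UnitaryGroup E) {χ v : E} (hχ : ‖χ‖ = 1)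
    (hv : HasDerivAt (fun t : ℝ => G.U t χ) v 0) :
    Tendsto (fun t : ℝ => (1 - ‖⟪χ, G.U t χ⟫_ℂ‖ ^ 2) / t ^ 2) (𝓝[>] 0)
      (𝓝 (‖v‖ ^ 2 - ‖⟪χ, v⟫_ℂ‖ ^ 2)) := by
  have h1 := (hasDerivAt_iff_tendsto_slope_zero.1 hv).mono_left
    (nhdsWithin_mono 0 (fun t (ht : (0 : ℝ) < t) => ht.ne'))
  have hc : Continuous fun x : E => ‖x - ⟪χ, x⟫_ℂ • χ‖ ^ 2 := by fun_prop
  rw [← norm_sub_inner_smul_sq hχ]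
  refine ((hc.tendsto v).comp h1).congr fun t => ?_
  have hU : 1 - ‖⟪χ, G.U t χ⟫_ℂ‖ ^ 2 = ‖G.U t χ - ⟪χ, G.U t χ⟫_ℂ • χ‖ ^ 2 := by
    rw [norm_sub_inner_smul_sq hχ, LinearIsometryEquiv.norm_map, hχ, one_pow]
  have e : (t⁻¹ • (G.U t χ - χ)) - ⟪χ, t⁻¹ • (G.U t χ - χ)⟫_ℂ • χ =
      t⁻¹ • (G.U t χ - ⟪χ, G.U t χ⟫_ℂ • χ) := by
    rw [← Complex.coe_smul, inner_smul_right, inner_sub_right, inner_self_eq_norm_sq_to_K, hχ,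
      mul_smul, ← smul_sub, ← Complex.coe_smul]
    congr 1
    simp only [Complex.coe_algebraMap, Complex.ofReal_one, one_pow, sub_smul, one_smul]
    abel
  simp only [Function.comp_apply, zero_add, G.U_zero]
  rw [e, hU, norm_smul, mul_pow, norm_inv, inv_pow, Real.norm_eq_abs, sq_abs]
  ring

theorem isPositive_pureState [CompleteSpace E] (χ : E) : (pureState χ).IsPositive := by
  rw [ContinuousLinearMap.isPositive_iff_complex]
  intro x
  have h : ⟪pureState χ x, x⟫_ℂ = ((‖⟪χ, x⟫_ℂ‖ ^ 2 : ℝ) : ℂ) := by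
    rw [pureState, InnerProductSpace.rankOne_apply, inner_smul_left,
      ← Complex.normSq_eq_conj_mul_self, Complex.normSq_eq_norm_sq]
  rw [h]
  exact ⟨rfl, by rw [RCLike.re_to_complex, Complex.ofReal_re]; positivity⟩

/-- Evaluated in a basis containing `χ`. Pairs avoiding `χ` have coefficient `0` by convention, the
diagonal entry at `χ` vanishes, and the remaining coefficients are `1 / f 0`. -/
theorem monotoneMetric_pureState_le [CompleteSpace E] (f : ℝ → ℝ) {χ : E} (hχ : ‖χ‖ = 1)
    {A : E →L[ℂ] E} (hA : IsSelfAdjoint A) (hAχ : ⟪χ, A χ⟫_ℂ = 0) :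
    monotoneMetric f (pureState χ) A ≤ 2 * (ENNReal.ofReal (f 0)⁻¹ * ‖A χ‖ₑ ^ 2) := by
  classical
  have hon : Orthonormal ℂ ((↑) : ({χ} : Set E) → E) := by
    refine ⟨fun i => by rw [i.2, hχ], fun i j hij => absurd (Subsingleton.elim i j) hij⟩
  obtain ⟨w, b, hw, hb⟩ := hon.exists_hilbertBasis_extension
  set i₀ : w := ⟨χ, hw rfl⟩ with hi₀
  have hbi₀ : b i₀ = χ := by rw [hb]
  have hort : ∀ i, i ≠ i₀ → ⟪χ, b i⟫_ℂ = 0 := fun i hi => by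
    rw [← hbi₀]
    exact b.orthonormal.2 hi.symm
  have hl : ∀ i, pureState χ (b i) = (((if i = i₀ then 1 else 0 : ℝ)) : ℂ) • b i := by
    intro i
    rw [pureState, InnerProductSpace.rankOne_apply]
    by_cases hi : i = i₀
    · rw [hi, hbi₀, inner_self_eq_norm_sq_to_K, hχ]
      simp
    · rw [hort i hi]
      simp [hi]
  unfold monotoneMetric
  refine (iInf₂_le_of_le w b (iInf₂_le _ hl)).trans ?_
  rw [← tsum_enorm_inner_sq b (A χ), ← ENNReal.tsum_mul_left, ← tsum_cross i₀]
  refine ENNReal.tsum_le_tsum fun i => ENNReal.tsum_le_tsum fun j => ?_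
  have hsymm : ∀ j, ‖⟪χ, A (b j)⟫_ℂ‖ₑ = ‖⟪b j, A χ⟫_ℂ‖ₑ := by
    intro j
    rw [← ofReal_norm, ← ofReal_norm, ← hA.isSymmetric.apply_clm, norm_inner_symm]
  by_cases hi : i = i₀ <;> by_cases hj : j = i₀
  · simp [hi, hj, hbi₀, hAχ]
  · simp [hi, hj, hbi₀, hsymm, morozovaChentsov]
  · simp [hi, hj, hbi₀, morozovaChentsov]
  · simp [hi, hj, morozovaChentsov]

/-- For pure states the metric adjusted skew information is the second-order coefficient of the
survival probability. -/
theorem skewInfo_pureState_of_hasDerivAt [CompleteSpace E] {f : ℝ → ℝ}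
    (hf : IsRegularStandardMonotone f) (G : UnitaryGroup E) {χ v : E} (hχ : ‖χ‖ = 1)
    (hv : HasDerivAt (fun t : ℝ => G.U t χ) v 0) :
    skewInfo f G (pureState χ) = ENNReal.ofReal (‖v‖ ^ 2 - ‖⟪χ, v⟫_ℂ‖ ^ 2) := by
  have hpos := isPositive_pureState χ
  have hf0 := hf.zero_pos
  apply le_antisymm
  · have hA := hasDerivAt_unitaryModel_pureState G hv
    have hAs := G.isSelfAdjoint_deriv_unitaryModel hpos.isSelfAdjoint hA
    have hre := re_inner_deriv_eq_zero G hv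
    have hconj : ⟪v, χ⟫_ℂ = -⟪χ, v⟫_ℂ := by
      rw [← inner_conj_symm]
      exact Complex.ext (by rw [Complex.conj_re, Complex.neg_re, hre, neg_zero])
        (by rw [Complex.conj_im, Complex.neg_im])
    set A := InnerProductSpace.rankOne ℂ χ v + InnerProductSpace.rankOne ℂ v χ with hAdef
    have hAχ : A χ = v - ⟪χ, v⟫_ℂ • χ := by
      rw [hAdef, _root_.add_apply, InnerProductSpace.rankOne_apply,
        InnerProductSpace.rankOne_apply, hconj, inner_self_eq_norm_sq_to_K, hχ]
      simp only [neg_smul, Complex.coe_algebraMap, Complex.ofReal_one, one_pow, one_smul]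
      abel
    have hdiag : ⟪χ, A χ⟫_ℂ = 0 := by
      rw [hAχ, inner_sub_right, inner_smul_right, inner_self_eq_norm_sq_to_K, hχ]
      simp
    unfold skewInfo quantumFisher
    rw [if_pos hA.differentiableAt, hA.deriv, unitaryModel_zero]
    refine (mul_le_mul_right (monotoneMetric_pureState_le f hχ hAs hdiag) _).trans (le_of_eq ?_)
    rw [enorm_sq_eq_ofReal, hAχ, norm_sub_inner_smul_sq hχ,
      show (2 : ℝ≥0∞) = ENNReal.ofReal 2 by simp,
      ← ENNReal.ofReal_mul (by positivity), ← ENNReal.ofReal_mul (by norm_num),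
      ← ENNReal.ofReal_mul (by positivity)]
    congr 1
    field_simp
  -- The lower bound for nearby states at `δ = 0`, where no error term remains and `t → 0` is
  -- allowed. It handles all eigenbases in the infimum at once.
  · refine le_of_tendsto (ENNReal.tendsto_ofReal (tendsto_one_sub_norm_inner_sq_div G hχ hv)) ?_
    filter_upwards [self_mem_nhdsWithin] with t ht
    have := le_skewInfo hf G hχ hpos le_rfl (by norm_num) (by simp) ht
    simpa [smoothingFactor_zero hf] using this

/-- With `v = -i H χ`, unitarity makes `⟨χ, v⟩` imaginary, so its modulus is that of the mean
energy. -/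
theorem variance_hamiltonian [CompleteSpace E] (G : UnitaryGroup E) (χ : G.hamiltonian.domain) :
    variance G.hamiltonian χ = ‖deriv (fun t : ℝ => G.U t (χ : E)) 0‖ ^ 2 -
      ‖⟪(χ : E), deriv (fun t : ℝ => G.U t (χ : E)) 0⟫_ℂ‖ ^ 2 := by
  have hv : HasDerivAt (fun t : ℝ => G.U t (χ : E)) _ 0 := DifferentiableAt.hasDerivAt χ.2
  have hre := re_inner_deriv_eq_zero G hv
  set v := deriv (fun t : ℝ => G.U t (χ : E)) 0 with hvdef
  have hH : G.hamiltonian χ = Complex.I • v := rfl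
  rw [variance, hH, norm_smul, Complex.norm_I, one_mul, inner_smul_right, Complex.I_mul_re, neg_sq,
    ← Complex.normSq_eq_norm_sq ⟪(χ : E), v⟫_ℂ, Complex.normSq_apply, hre]
  ring

end Pure

end Asymmetry

namespace Asymmetry

open UnitaryGroup

/-! ### Bounds on the smooth skew information -/

section Smooth

variable {E : Type u} [NormedAddCommGroup E] [InnerProductSpace ℂ E] [CompleteSpace E]

theorem isState_pureState {χ : E} (hχ : ‖χ‖ = 1) : IsState (pureState χ) := by
  refine ⟨isPositive_pureState χ, ?_⟩
  unfold posTrace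
  simp_rw [re_inner_pureState, norm_inner_symm χ, ← enorm_sq_eq_ofReal]
  rw [tsum_enorm_inner_sq, enorm_sq_eq_ofReal, hχ]
  simp

theorem smoothSkewInfo_le_skewInfo (f : ℝ → ℝ) (ε : ℝ) (G : UnitaryGroup E) {ρ : E →L[ℂ] E}
    (hρ : IsState ρ) : smoothSkewInfo f ε G ρ ≤ skewInfo f G ρ :=
  iInf_le_of_le ρ (iInf₂_le hρ (by simp [traceDist_self]))

theorem le_smoothSkewInfo {f : ℝ → ℝ} (hf : IsRegularStandardMonotone f) (G : UnitaryGroup E)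
    {φ : E} (hφ : ‖φ‖ = 1) {ε : ℝ} (hε : 0 ≤ ε) (hε8 : ε < 1 / 8) {t : ℝ} (ht : 0 < t) :
    ENNReal.ofReal (smoothingFactor f (2 * ε) *
      ((1 - ‖⟪φ, G.U t φ⟫_ℂ‖ ^ 2 - 8 * √(2 * ε)) / t ^ 2)) ≤
      smoothSkewInfo f ε G (pureState φ) :=
  le_iInf fun _ => le_iInf fun hσ => le_iInf fun h =>
    le_skewInfo hf G hφ hσ.1 (by positivity) (by linarith) (norm_sub_le_of_traceDist_le hε h) ht

end Smooth

/-! ### Independent copies and additivity -/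

section Copies

variable (S : QSystem.{u})

theorem QSystem.norm_tpow {ψ : S.carrier} (hψ : ‖ψ‖ = 1) (k : ℕ) : ‖S.tpow ψ k‖ = 1 := by
  induction k with
  | zero =>
    change ‖(EuclideanSpace.single PUnit.unit (1 : ℂ) : EuclideanSpace ℂ PUnit.{u + 1})‖ = 1
    simp
  | succ k ih =>
    change ‖hTmul ψ (S.tpow ψ k)‖ = 1
    rw [hTmul, UniformSpace.Completion.norm_coe, TensorProduct.norm_tmul, hψ, ih, one_mul]

theorem QSystem.inner_tpow_U_tpow (ψ : S.carrier) (t : ℝ) (k : ℕ) :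
    ⟪S.tpow ψ k, (S.copies k).evol.U t (S.tpow ψ k)⟫_ℂ = ⟪ψ, S.evol.U t ψ⟫_ℂ ^ k := by
  induction k with
  | zero =>
    change ⟪(EuclideanSpace.single PUnit.unit (1 : ℂ) : EuclideanSpace ℂ PUnit.{u + 1}),
      (EuclideanSpace.single PUnit.unit (1 : ℂ) : EuclideanSpace ℂ PUnit.{u + 1})⟫_ℂ = _
    simp
  | succ k ih =>
    change ⟪hTmul ψ (S.tpow ψ k),
      hMap (S.evol.U t) ((S.copies k).evol.U t) (hTmul ψ (S.tpow ψ k))⟫_ℂ = _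
    rw [hMap_hTmul, inner_hTmul, ih, pow_succ']

theorem QSystem.tpow_mem_domain {ψ : S.carrier} (hψ : ψ ∈ S.evol.hamiltonian.domain) (k : ℕ) :
    S.tpow ψ k ∈ (S.copies k).evol.hamiltonian.domain := by
  induction k with
  | zero => exact differentiableAt_const _
  | succ k ih => exact (hamiltonian_prod_hTmul S.evol (S.copies k).evol ⟨ψ, hψ⟩ ⟨_, ih⟩).choose

theorem tendsto_one_sub_pow_div {a : ℝ → ℝ} {V : ℝ} (ha : Tendsto a (𝓝[>] 0) (𝓝 1))
    (h : Tendsto (fun t => (1 - a t) / t ^ 2) (𝓝[>] 0) (𝓝 V)) (k : ℕ) :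
    Tendsto (fun t => (1 - a t ^ k) / t ^ 2) (𝓝[>] 0) (𝓝 (k * V)) := by
  have h1 : Tendsto (fun t => (∑ i ∈ Finset.range k, a t ^ i) * ((1 - a t) / t ^ 2)) (𝓝[>] 0)
      (𝓝 ((∑ i ∈ Finset.range k, (1 : ℝ) ^ i) * V)) :=
    (tendsto_finsetSum _ fun i _ => ha.pow i).mul h
  refine (h1.congr fun t => ?_).trans_eq (by simp)
  rw [← mul_div_assoc, geom_sum_mul_neg]

/-- Both sides are limits of `(1 - q(t)^k) / t²`, with `q` the survival probability of one copy.
This avoids computing the variance of the total Hamiltonian. -/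
theorem QSystem.skewInfo_tpow {f : ℝ → ℝ} (hf : IsRegularStandardMonotone f) {ψ : S.carrier}
    (hψ : ‖ψ‖ = 1) (hd : ψ ∈ S.evol.hamiltonian.domain) (k : ℕ) :
    skewInfo f (S.copies k).evol (pureState (S.tpow ψ k)) =
      ENNReal.ofReal (k * variance S.evol.hamiltonian ⟨ψ, hd⟩) := by
  have hv : HasDerivAt (fun t : ℝ => S.evol.U t ψ) _ 0 := DifferentiableAt.hasDerivAt hd
  have hvk : HasDerivAt (fun t : ℝ => (S.copies k).evol.U t (S.tpow ψ k)) _ 0 :=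
    DifferentiableAt.hasDerivAt (S.tpow_mem_domain hd k)
  rw [skewInfo_pureState_of_hasDerivAt hf _ (S.norm_tpow hψ k) hvk, variance_hamiltonian]
  congr 1
  refine tendsto_nhds_unique
    (tendsto_one_sub_norm_inner_sq_div _ (S.norm_tpow hψ k) hvk) ?_
  have hc : Continuous fun t => ‖⟪ψ, S.evol.U t ψ⟫_ℂ‖ ^ 2 :=
    ((continuous_const.inner (S.evol.continuous ψ)).norm).pow 2
  have h1 : Tendsto (fun t => ‖⟪ψ, S.evol.U t ψ⟫_ℂ‖ ^ 2) (𝓝[>] 0) (𝓝 1) := by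
    have := hc.tendsto 0
    rw [S.evol.U_zero, inner_self_eq_norm_sq_to_K, hψ] at this
    simp only [Complex.coe_algebraMap, Complex.ofReal_one, one_pow, norm_one] at this
    exact this.mono_left nhdsWithin_le_nhds
  refine (tendsto_one_sub_pow_div h1 (tendsto_one_sub_norm_inner_sq_div _ hψ hv) k).congr
    fun t => ?_
  rw [S.inner_tpow_U_tpow, norm_pow, ← pow_mul, ← pow_mul, mul_comm]

end Copies

/-! ### Asymptotic rates -/

section Rates

theorem tendsto_one_sub_exp_div (V : ℝ) :
    Tendsto (fun x : ℝ => (1 - Real.exp (-(V * x))) / x) (𝓝[>] 0) (𝓝 V) := by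
  have h : HasDerivAt (fun x : ℝ => 1 - Real.exp (-(V * x))) V 0 := by
    have := (((hasDerivAt_id (0 : ℝ)).const_mul V).neg.exp).const_sub 1
    simpa using this
  refine ((hasDerivAt_iff_tendsto_slope_zero.1 h).mono_left
    (nhdsWithin_mono 0 (fun t (ht : (0 : ℝ) < t) => ht.ne'))).congr fun x => ?_
  simp only [zero_add, mul_zero, neg_zero, Real.exp_zero, sub_self, sub_zero, smul_eq_mul]
  ring

theorem tendsto_ceil_atTop {R : ℝ} (hR : 0 < R) :
    Tendsto (fun m : ℕ => ⌈R * m⌉₊) atTop atTop :=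
  tendsto_nat_ceil_atTop.comp (tendsto_natCast_atTop_atTop.const_mul_atTop hR)

theorem tendsto_ceil_div {R : ℝ} (hR : 0 < R) :
    Tendsto (fun m : ℕ => (⌈R * m⌉₊ : ℝ) / m) atTop (𝓝 R) :=
  (tendsto_nat_ceil_mul_div_atTop hR.le).comp tendsto_natCast_atTop_atTop

theorem ofReal_div_natCast (x : ℝ) {m : ℕ} (hm : 0 < m) :
    ENNReal.ofReal x / (m : ℝ≥0∞) = ENNReal.ofReal (x / m) := by
  rw [ENNReal.ofReal_div_of_pos (by positivity), ENNReal.ofReal_natCast]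

/-- Survival probabilities of many copies are asymptotically Gaussian on the scale `1 / √k`. -/
theorem pow_le_exp {q x : ℝ} {k : ℕ} (hk : 0 < k) (hx : 0 < x) (hq : 0 ≤ q) :
    q ^ k ≤ Real.exp (-((1 - q) / √(x / k) ^ 2 * x)) := by
  have hk' : (0 : ℝ) < k := by positivity
  have e : -((1 - q) / √(x / k) ^ 2 * x) = k * (q - 1) := by
    rw [Real.sq_sqrt (by positivity)]
    field_simp
    ring
  rw [e, Real.exp_nat_mul]
  gcongr
  linarith [Real.add_one_le_exp (q - 1)]

/-- The lower bound on the rate of the smooth skew information of many copies of a pure state. -/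
theorem eventually_le_liminf_smoothSkewInfo {f : ℝ → ℝ} (hf : IsRegularStandardMonotone f)
    (S : QSystem.{u}) {ψ : S.carrier} (hψ : ‖ψ‖ = 1) {V : ℝ}
    (hV : Tendsto (fun t : ℝ => (1 - ‖⟪ψ, S.evol.U t ψ⟫_ℂ‖ ^ 2) / t ^ 2) (𝓝[>] 0) (𝓝 V))
    {R : ℝ} (hR : 0 < R) {a : ℝ} (ha : a < R * V) :
    ∀ᶠ ε : ℝ in 𝓝[>] 0, ENNReal.ofReal a ≤ liminf (fun m : ℕ =>
      smoothSkewInfo f ε (S.copies ⌈R * m⌉₊).evol (pureState (S.tpow ψ ⌈R * m⌉₊)) /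
        (m : ℝ≥0∞)) atTop := by
  -- The rescaled time `x` is fixed before `ε`, so that the smoothing error `8 √(2 * ε) / x` can be
  -- made small.
  obtain ⟨x, hxa, hx⟩ : ∃ x : ℝ, a < R * ((1 - Real.exp (-(V * x))) / x) ∧ 0 < x :=
    (((tendsto_one_sub_exp_div V).const_mul R).eventually_const_lt ha |>.and
      self_mem_nhdsWithin).exists
  have hid : Tendsto (fun ε : ℝ => 2 * ε) (𝓝[>] 0) (𝓝[>] 0) := by
    refine tendsto_nhdsWithin_iff.2 ⟨?_, ?_⟩
    · have : Tendsto (fun ε : ℝ => 2 * ε) (𝓝 0) (𝓝 (2 * 0)) := tendsto_id.const_mul 2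
      rw [mul_zero] at this
      exact this.mono_left nhdsWithin_le_nhds
    · filter_upwards [self_mem_nhdsWithin] with ε hε
      exact Set.mem_Ioi.2 (mul_pos two_pos (Set.mem_Ioi.1 hε))
  have hsqrt : Tendsto (fun ε : ℝ => √(2 * ε)) (𝓝[>] 0) (𝓝 0) := by
    have := (Real.continuous_sqrt.tendsto 0).comp (hid.mono_right nhdsWithin_le_nhds)
    rwa [Real.sqrt_zero] at this
  have hlim : Tendsto (fun ε : ℝ => smoothingFactor f (2 * ε) *
      ((1 - Real.exp (-(V * x)) - 8 * √(2 * ε)) / x * R)) (𝓝[>] 0)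
      (𝓝 (1 * ((1 - Real.exp (-(V * x)) - 8 * 0) / x * R))) :=
    ((tendsto_smoothingFactor hf).comp hid).mul
      (((tendsto_const_nhds.sub (hsqrt.const_mul 8)).div_const x).mul_const R)
  have hlt : a < 1 * ((1 - Real.exp (-(V * x)) - 8 * 0) / x * R) := by
    rwa [one_mul, mul_zero, sub_zero, mul_comm]
  filter_upwards [hlim.eventually_const_lt hlt,
    Ioo_mem_nhdsGT (show (0 : ℝ) < 1 / 8 by norm_num)] with ε hε hε8
  have hε0 : 0 < ε := hε8.1
  have hε1 : ε < 1 / 8 := hε8.2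
  set k : ℕ → ℕ := fun m => ⌈R * m⌉₊ with hk
  set q : ℝ → ℝ := fun t => ‖⟪ψ, S.evol.U t ψ⟫_ℂ‖ ^ 2 with hq
  -- At this time one copy moves infinitesimally, while the overlap of all `k m` copies changes by a
  -- fixed amount.
  have htime : Tendsto (fun m : ℕ => √(x / k m)) atTop (𝓝[>] 0) := by
    refine tendsto_nhdsWithin_iff.2 ⟨?_, ?_⟩
    · have := (Real.continuous_sqrt.tendsto 0).comp
        ((tendsto_const_div_atTop_nhds_zero_nat x).comp (tendsto_ceil_atTop hR))
      rwa [Real.sqrt_zero] at this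
    · filter_upwards [(tendsto_ceil_atTop hR).eventually_gt_atTop 0] with m hm
      have : (0 : ℝ) < k m := by exact_mod_cast hm
      exact Real.sqrt_pos.2 (by positivity)
  have hb : Tendsto (fun m : ℕ => smoothingFactor f (2 * ε) *
      ((1 - Real.exp (-((1 - q (√(x / k m))) / √(x / k m) ^ 2 * x)) - 8 * √(2 * ε)) / x *
        (k m / m))) atTop (𝓝 (smoothingFactor f (2 * ε) *
      ((1 - Real.exp (-(V * x)) - 8 * √(2 * ε)) / x * R))) := by
    have h1 := (Real.continuous_exp.tendsto _).comp ((hV.comp htime).mul_const x).neg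
    exact ((((h1.const_sub 1).sub_const _).div_const x).mul (tendsto_ceil_div hR)).const_mul _
  refine le_liminf_of_le (by isBoundedDefault) ?_
  filter_upwards [hb.eventually_const_lt hε, (tendsto_ceil_atTop hR).eventually_gt_atTop 0,
    eventually_gt_atTop 0] with m hm hkm hm0
  have hk0 : (0 : ℝ) < k m := by exact_mod_cast hkm
  have hm0' : (0 : ℝ) < m := by positivity
  have ht : 0 < √(x / k m) := Real.sqrt_pos.2 (by positivity)
  refine le_trans ?_ (ENNReal.div_le_div_right
    (le_smoothSkewInfo hf _ (S.norm_tpow hψ (k m)) hε0.le hε1 ht) _)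
  rw [ofReal_div_natCast _ hm0]
  refine ENNReal.ofReal_le_ofReal (hm.le.trans ?_)
  rw [mul_div_assoc]
  refine mul_le_mul_of_nonneg_left ?_ (smoothingFactor_nonneg hf (by positivity) (by linarith))
  have hpow := pow_le_exp (k := k m) hkm hx (q := q (√(x / k m))) (by positivity)
  rw [S.inner_tpow_U_tpow, norm_pow, ← pow_mul, mul_comm (k m) 2, pow_mul]
  change _ ≤ (1 - q (√(x / k m)) ^ k m - 8 * √(2 * ε)) / √(x / k m) ^ 2 / m
  calc _ ≤ (1 - q (√(x / k m)) ^ k m - 8 * √(2 * ε)) / x * (k m / m) := by gcongr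
    _ = _ := by
      rw [Real.sq_sqrt (by positivity)]
      field_simp

end Rates

end Asymmetry

theorem theorem2 (f : ℝ → ℝ) (hf : IsRegularStandardMonotone f)
    (S : QSystem.{u}) (ψ : S.carrier) (hψ : ‖ψ‖ = 1)
    (hperiod : period S.evol ψ = 2 * Real.pi)
    (hmoment : FiniteAbsMoment S.evol ψ 3)
    (R : ℝ) (hR : 0 < R) :
    HasSmoothSupRate f (fun m : ℕ => S.copies ⌈R * m⌉₊)
        (fun m : ℕ => pureState (S.tpow ψ ⌈R * m⌉₊))
        (ENNReal.ofReal R * skewInfo f S.evol (pureState ψ)) ∧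
      HasSmoothInfRate f (fun m : ℕ => S.copies ⌈R * m⌉₊)
        (fun m : ℕ => pureState (S.tpow ψ ⌈R * m⌉₊))
        (ENNReal.ofReal R * skewInfo f S.evol (pureState ψ)) ∧
      Tendsto (fun m : ℕ =>
          skewInfo f (S.copies ⌈R * m⌉₊).evol (pureState (S.tpow ψ ⌈R * m⌉₊)) / (m : ℝ≥0∞))
        atTop (𝓝 (ENNReal.ofReal R * skewInfo f S.evol (pureState ψ))) ∧
      ∃ hdom : ψ ∈ S.H.domain,
        skewInfo f S.evol (pureState ψ) = ENNReal.ofReal (variance S.H ⟨ψ, hdom⟩) := by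
  have hd : ψ ∈ S.evol.hamiltonian.domain :=
    differentiableAt_of_finiteAbsMoment_two hmoment.two_of_three
  have hv : HasDerivAt (fun t : ℝ => S.evol.U t ψ) _ 0 := DifferentiableAt.hasDerivAt hd
  set V := variance S.evol.hamiltonian ⟨ψ, hd⟩ with hVdef
  have hskew : skewInfo f S.evol (pureState ψ) = ENNReal.ofReal V := by
    rw [skewInfo_pureState_of_hasDerivAt hf _ hψ hv, hVdef, variance_hamiltonian]
  have hV := tendsto_one_sub_norm_inner_sq_div S.evol hψ hv
  rw [← variance_hamiltonian S.evol ⟨ψ, hd⟩, ← hVdef] at hV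
  rw [hskew, ← ENNReal.ofReal_mul hR.le]
  have hrate : Tendsto (fun m : ℕ =>
      skewInfo f (S.copies ⌈R * m⌉₊).evol (pureState (S.tpow ψ ⌈R * m⌉₊)) / (m : ℝ≥0∞))
      atTop (𝓝 (ENNReal.ofReal (R * V))) := by
    refine (ENNReal.tendsto_ofReal ((tendsto_ceil_div hR).mul_const V)).congr' ?_
    filter_upwards [eventually_gt_atTop 0] with m hm
    rw [S.skewInfo_tpow hf hψ hd, ofReal_div_natCast _ hm, div_mul_eq_mul_div]
  have hle : ∀ (ε : ℝ) (m : ℕ),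
      smoothSkewInfo f ε (S.copies ⌈R * m⌉₊).evol (pureState (S.tpow ψ ⌈R * m⌉₊)) / (m : ℝ≥0∞) ≤
        skewInfo f (S.copies ⌈R * m⌉₊).evol (pureState (S.tpow ψ ⌈R * m⌉₊)) / (m : ℝ≥0∞) :=
    fun ε m => ENNReal.div_le_div_right
      (smoothSkewInfo_le_skewInfo f ε _ (isState_pureState (S.norm_tpow hψ _))) _
  have hsup : ∀ ε : ℝ, limsup (fun m : ℕ => smoothSkewInfo f ε (S.copies ⌈R * m⌉₊).evol
      (pureState (S.tpow ψ ⌈R * m⌉₊)) / (m : ℝ≥0∞)) atTop ≤ ENNReal.ofReal (R * V) := fun ε =>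
    (limsup_le_limsup (Eventually.of_forall (hle ε))).trans hrate.limsup_eq.le
  have hinf : Tendsto (fun ε : ℝ => liminf (fun m : ℕ => smoothSkewInfo f ε
      (S.copies ⌈R * m⌉₊).evol (pureState (S.tpow ψ ⌈R * m⌉₊)) / (m : ℝ≥0∞)) atTop) (𝓝[>] 0)
      (𝓝 (ENNReal.ofReal (R * V))) := by
    -- The upper estimate holds for every `ε`; only the lower one needs `ε` small.
    refine tendsto_order.2 ⟨fun a ha => ?_, fun a ha => Eventually.of_forall fun ε =>
      ((liminf_le_limsup (by isBoundedDefault) (by isBoundedDefault)).trans (hsup ε)).trans_lt ha⟩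
    obtain ⟨r, hr, har, hrL⟩ := ENNReal.lt_iff_exists_real_btwn.1 ha
    have hrV : r < R * V := (ENNReal.ofReal_lt_ofReal_iff'.1 hrL).1
    filter_upwards [eventually_le_liminf_smoothSkewInfo hf S hψ hV hR hrV] with ε hε
    exact har.trans_le hε
  refine ⟨?_, hinf, hrate, hd, rfl⟩
  exact tendsto_of_tendsto_of_tendsto_of_le_of_le hinf tendsto_const_nhds
    (fun ε => liminf_le_limsup) hsup
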